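/- Let $M$ be a matroid on a finite set $E$ and $M'$ a matroid on a finite set $E'$. Write $P(M)\subset\mathbb{R}^E$ for the base polytope of $M$ (the convex hull of the indicator vectors of its bases). A weak map $\varphi\colon M\to M'$ is a bijection $\varphi\colon E\to E'$ such that $P(M')\subset\varphi(P(M))$, where $\varphi$ also denotes the induced isomorphism $\mathbb{R}^E\to\mathbb{R}^{E'}$. **Whitney spaces.** For a strictly increasing tuple $\mathbf{k}$ of natural numbers, indexed by a finite set of consecutive integers, let $\Phi_{\mathbf{k}}(M)$ be the $\mathbb{Q}$-vector space with basis the flags of flats $(F_i)_i$ of $M$, $F_i\subseteq F_j$ for $i\le j$, with $\operatorname{rk}F_i=k_i$ for all $i$. A weak map $\varphi\colon M\to M'$ induces the linear map $\Phi_{\mathbf{k}}(\varphi)\colon\Phi_{\mathbf{k}}(M)\to\Phi_{\mathbf{k}}(M')$ that sends a flag $(F_i)_i$ to the flag $(\overline{\varphi(F_i)})_i$ of closures in $M'$ if $\operatorname{rk}_{M'}\varphi(F_i)=k_i$ for all $i$, and to $0$ otherwise. **Chow functors.** For $k\ge1$ let $Q_k$ be the graded $\mathbb{Q}$-vector space that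 is one-dimensional in each degree $i$ with $0<i<k$ and zero in all other degrees, and let $V(-n)$ denote $V$ shifted up by $n$ degrees. If $M$ has no loops, put $$\underline{\mathrm{CH}}(M)=\bigoplus_{r\ge0}\ \bigoplus_{0<k_1<\cdots<k_r}\Phi_{(k_1,\dots,k_r)}(M)\otimes Q_{k_1}\otimes Q_{k_2-k_1}\otimes\cdots\otimes Q_{k_r-k_{r-1}},$$ and put $\underline{\mathrm{CH}}(M)=0$ if $M$ has a loop. For every $M$ put $$\mathrm{CH}(M)=\bigoplus_{r\ge0}\ \bigoplus_{0\le k_0<k_1<\cdots<k_r}\Phi_{(k_0,\dots,k_r)}(M)\otimes \bigl(Q_{k_1-k_0}\otimes\cdots\otimes Q_{k_r-k_{r-1}}\bigr)(-k_0).$$ A weak map $\varphi\colon M\to M'$ induces graded linear maps $\underline{\mathrm{CH}}(\varphi)\colon\underline{\mathrm{CH}}(M)\to\underline{\mathrm{CH}}(M')$ and $\mathrm{CH}(\varphi)\colon\mathrm{CH}(M)\to\mathrm{CH}(M')$, given by the maps $\Phi_{\mathbf{k}}(\varphi)$ tensored with identities (the first map is $0$ if $M'$ has a loop; if $M'$ has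 no loops, neither has $M$). **Chow polynomials.** The augmented Chow ring of $M$ is the quotient of $\mathbb{Q}[x_F,y_e\mid F\text{ a flat of }M,\ e\in E]$ by the ideal generated by $\sum_F x_F$, by $y_e-\sum_{F\not\ni e}x_F$ for $e\in E$, by $y_ex_F$ for $e\notin F$, and by $x_Fx_G$ for incomparable flats $F,G$. The Chow ring of $M$ is the quotient of the augmented Chow ring by the ideal generated by all $y_e$ if $M$ has no loops, and is $0$ if $M$ has a loop. Both are graded with all $x_F$ and $y_e$ in degree $1$. Let $\underline{H}_M(t)$ and $H_M(t)$ be the Hilbert series $\sum_i t^i\dim_{\mathbb{Q}}(\,\cdot\,)_i$ of the Chow ring and of the augmented Chow ring, respectively. **Statement.** For any weak map $\varphi\colon M\to M'$, the maps $\underline{\mathrm{CH}}(\varphi)\colon\underline{\mathrm{CH}}(M)\to\underline{\mathrm{CH}}(M')$ and $\mathrm{CH}(\varphi)\colon\mathrm{CH}(M)\to\mathrm{CH}(M')$ are both surjective (in every degree). Moreover $\underline{H}_M(t)$, $\underline{H}_{M'}(t)$, $H_M(t)$ and $H_{M'}(t)$ are polynomials, and the polynomials $$\underline{H}_M(t)-\underline{H}_{M'}(t)\qquad\text{and}\qquad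 H_M(t)-H_{M'}(t)$$ have non-negative coefficients. -/

import Mathlib

open scoped TensorProduct DirectSum

namespace MatroidChow

universe u v

noncomputable section

/-! ### Weak maps -/

/-- The base polytope of a matroid on `E`: the convex hull in `ℝ^E` of the indicator vectors of
the bases. -/
def basePolytope {E : Type u} (M : Matroid E) : Set (E → ℝ) :=
  convexHull ℝ {p | ∃ B : Set E, M.IsBase B ∧ p = B.indicator 1}

/-- A bijection `φ : E ≃ E'` is a weak map `(E, M) → (E', M')` if `P(M') ⊆ φ(P(M))`, where `φ` acts
by the linear isomorphism `ℝ^E ≃ ℝ^E'` sending the basis vector of `e` to the one of `φ e`. -/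
def IsWeakMap {E : Type u} {E' : Type v} (φ : E ≃ E') (M : Matroid E) (M' : Matroid E') : Prop :=
  basePolytope M' ⊆ LinearEquiv.funCongrLeft ℝ ℝ φ.symm '' basePolytope M

/-! ### Chow rings and Chow polynomials -/

/-- The flats of `M`. -/
abbrev Flat {E : Type u} (M : Matroid E) : Type u := {F : Set E // M.IsFlat F}

/-- The polynomial ring `ℚ[x_F | F a flat] ⊗ ℚ[y_e | e ∈ E]`. -/
abbrev PolyRing {E : Type u} (M : Matroid E) : Type u := MvPolynomial (Flat M ⊕ E) ℚ

/-- The variable `x_F`. -/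
def x {E : Type u} {M : Matroid E} (F : Flat M) : PolyRing M := MvPolynomial.X (Sum.inl F)

/-- The variable `y_e`. -/
def y {E : Type u} (M : Matroid E) (e : E) : PolyRing M := MvPolynomial.X (Sum.inr e)

/-- The ideal of relations of the augmented Chow ring. -/
def augChowIdeal {E : Type u} (M : Matroid E) : Ideal (PolyRing M) :=
  Ideal.span {∑ᶠ F : Flat M, x F}
    ⊔ Ideal.span {p | ∃ e : E, p = y M e - ∑ᶠ (F : Flat M) (_ : e ∉ F.1), x F}
    ⊔ Ideal.span {p | ∃ (e : E) (F : Flat M), e ∉ F.1 ∧ p = y M e * x F}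
    ⊔ Ideal.span {p | ∃ F G : Flat M, ¬ F.1 ⊆ G.1 ∧ ¬ G.1 ⊆ F.1 ∧ p = x F * x G}

/-- The augmented Chow ring of `M`. -/
abbrev AugChowRing {E : Type u} (M : Matroid E) : Type u := PolyRing M ⧸ augChowIdeal M

open Classical in
/-- The ideal of the augmented Chow ring generated by all `y_e` if `M` has no loops, and the whole
ring if `M` has a loop. -/
def chowIdeal {E : Type u} (M : Matroid E) : Ideal (AugChowRing M) :=
  if M.Loopless then
    Ideal.span (Set.range fun e : E => Ideal.Quotient.mk (augChowIdeal M) (y M e))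
  else ⊤

/-- The Chow ring of `M`: the quotient of the augmented Chow ring by all `y_e` if `M` has no loops,
and the zero ring otherwise. -/
abbrev ChowRing {E : Type u} (M : Matroid E) : Type u := AugChowRing M ⧸ chowIdeal M

/-- The degree `d` part of the augmented Chow ring (every `x_F` and every `y_e` has degree `1`). -/
def augChowRingPiece {E : Type u} (M : Matroid E) (d : ℕ) : Submodule ℚ (AugChowRing M) :=
  (MvPolynomial.homogeneousSubmodule (Flat M ⊕ E) ℚ d).map
    (Ideal.Quotient.mkₐ ℚ (augChowIdeal M)).toLinearMap

/-- The degree `d` part of the Chow ring. -/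
def chowRingPiece {E : Type u} (M : Matroid E) (d : ℕ) : Submodule ℚ (ChowRing M) :=
  (augChowRingPiece M d).map (Ideal.Quotient.mkₐ ℚ (chowIdeal M)).toLinearMap

/-- The generating function of the dimensions of the graded pieces of the augmented Chow ring. -/
def augChowSeries {E : Type u} (M : Matroid E) : PowerSeries ℤ :=
  PowerSeries.mk fun d => (Module.finrank ℚ (augChowRingPiece M d) : ℤ)

/-- The generating function of the dimensions of the graded pieces of the Chow ring. -/
def chowSeries {E : Type u} (M : Matroid E) : PowerSeries ℤ :=
  PowerSeries.mk fun d => (Module.finrank ℚ (chowRingPiece M d) : ℤ)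

/-! ### Whitney spaces and the maps between them -/

/-- Flags `F_1 ⊆ ⋯ ⊆ F_r` of flats of `M` with `rk F_i = k_i`. -/
def Flag {E : Type u} (M : Matroid E) {r : ℕ} (k : Fin r → ℕ) : Type u :=
  {F : Fin r → Set E // (∀ i, M.IsFlat (F i) ∧ M.eRk (F i) = (k i : ℕ∞)) ∧ Monotone F}

/-- The vector space with basis the flags of flats of ranks `k`. -/
abbrev Whitney {E : Type u} (M : Matroid E) {r : ℕ} (k : Fin r → ℕ) : Type u := Flag M k →₀ ℚ

/-- The flag of the closures in `M'` of the images of the members of a flag of `M`, when these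
images still have the ranks `k`. -/
def Flag.push {E : Type u} {E' : Type v} {M : Matroid E} (φ : E ≃ E') (M' : Matroid E')
    {r : ℕ} {k : Fin r → ℕ} (F : Flag M k) (h : ∀ i, M'.eRk (φ '' F.1 i) = (k i : ℕ∞)) :
    Flag M' k :=
  ⟨fun i => M'.closure (φ '' F.1 i),
    fun i => ⟨M'.isFlat_closure _, by rw [Matroid.eRk_closure_eq, h i]⟩,
    fun _ _ hij => M'.closure_subset_closure (Set.image_mono (F.2.2 hij))⟩

open Classical in
/-- The linear map `Φ_k(φ)`: it sends a flag `F` to the flag of the closures of the `φ(F_i)` if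
`rk_{M'} φ(F_i) = k_i` for all `i`, and to `0` otherwise. -/
def whitneyMap {E : Type u} {E' : Type v} (φ : E ≃ E') (M : Matroid E) (M' : Matroid E')
    {r : ℕ} (k : Fin r → ℕ) : Whitney M k →ₗ[ℚ] Whitney M' k :=
  Finsupp.linearCombination ℚ fun F : Flag M k =>
    if h : ∀ i, M'.eRk (φ '' F.1 i) = (k i : ℕ∞) then Finsupp.single (F.push φ M' h) (1 : ℚ) else 0

/-! ### The Chow functors -/

/-- The degree `i` part of the graded vector space `Q_k`: one-dimensional for `0 < i < k`, and zero
for all other `i`. -/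
abbrev QPiece (k i : ℕ) : Type := PLift (0 < i ∧ i < k) →₀ ℚ

/-- The degree `d` part of the graded tensor product
`(Q_{k_1 - k_0} ⊗ Q_{k_2 - k_1} ⊗ ⋯ ⊗ Q_{k_r - k_{r-1}})(-n)`, where `k = (k_0, …, k_r)`. -/
abbrev QTensor {r : ℕ} (k : Fin (r + 1) → ℕ) (n d : ℕ) : Type :=
  ⨁ m : {m : Fin r → ℕ // n + ∑ i, m i = d},
    ⨂[ℚ] i : Fin r, QPiece (k i.succ - k i.castSucc) (m.1 i)

/-- Tuples `k = (k_1, …, k_r)` of any length `r ≥ 0` with `0 < k_1 < ⋯ < k_r`. -/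
abbrev PosTuple : Type := Σ r : ℕ, {k : Fin r → ℕ // StrictMono k ∧ ∀ i, 0 < k i}

/-- Tuples `k = (k_0, …, k_r)` with `r ≥ 0` and `k_0 < k_1 < ⋯ < k_r`. -/
abbrev AugTuple : Type := Σ r : ℕ, {k : Fin (r + 1) → ℕ // StrictMono k}

/-- The degree `d` part of
`⨁_k Φ_k(M) ⊗ Q_{k_1} ⊗ Q_{k_2 - k_1} ⊗ ⋯ ⊗ Q_{k_r - k_{r-1}}`, over `0 < k_1 < ⋯ < k_r`. -/
abbrev ChowSumPiece {E : Type u} (M : Matroid E) (d : ℕ) : Type u :=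
  ⨁ k : PosTuple, Whitney M k.2.1 ⊗[ℚ] QTensor (Fin.cons 0 k.2.1 : Fin (k.1 + 1) → ℕ) 0 d

/-- The map induced by the maps `Φ_k(φ)` on the spaces `ChowSumPiece`. -/
def chowSumMap {E : Type u} {E' : Type v} (φ : E ≃ E') (M : Matroid E) (M' : Matroid E') (d : ℕ) :
    ChowSumPiece M d →ₗ[ℚ] ChowSumPiece M' d :=
  DirectSum.lmap fun k : PosTuple =>
    (whitneyMap φ M M' k.2.1).rTensor (QTensor (Fin.cons 0 k.2.1 : Fin (k.1 + 1) → ℕ) 0 d)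

/-- The degree `d` part of the Chow functor on objects: `ChowSumPiece M d` if `M` has no loops, and
zero otherwise (functions on an empty type). -/
abbrev ChowPiece {E : Type u} (M : Matroid E) (d : ℕ) : Type u :=
  PLift M.Loopless → ChowSumPiece M d

open Classical in
/-- The degree `d` part of the Chow functor on a morphism `φ`: `chowSumMap` if neither matroid has
loops, and zero otherwise. -/
def chowMap {E : Type u} {E' : Type v} (φ : E ≃ E') (M : Matroid E) (M' : Matroid E') (d : ℕ) :
    ChowPiece M d →ₗ[ℚ] ChowPiece M' d :=
  LinearMap.pi fun _ =>
    if h : M.Loopless then chowSumMap φ M M' d ∘ₗ LinearMap.proj (PLift.up h) else 0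

/-- The degree `d` part of the augmented Chow functor on objects:
`⨁_k Φ_k(M) ⊗ (Q_{k_1 - k_0} ⊗ ⋯ ⊗ Q_{k_r - k_{r-1}})(-k_0)`, over `k_0 < k_1 < ⋯ < k_r`. -/
abbrev AugChowPiece {E : Type u} (M : Matroid E) (d : ℕ) : Type u :=
  ⨁ k : AugTuple, Whitney M k.2.1 ⊗[ℚ] QTensor k.2.1 (k.2.1 0) d

/-- The degree `d` part of the augmented Chow functor on a morphism `φ`. -/
def augChowMap {E : Type u} {E' : Type v} (φ : E ≃ E') (M : Matroid E) (M' : Matroid E') (d : ℕ) :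
    AugChowPiece M d →ₗ[ℚ] AugChowPiece M' d :=
  DirectSum.lmap fun k : AugTuple =>
    (whitneyMap φ M M' k.2.1).rTensor (QTensor k.2.1 (k.2.1 0) d)

end

end MatroidChow

/-!
A weak map `φ : M → M'` carries sets independent in `M'` back to sets independent in `M`, since the
vertices of `P(M')` are vertices of `φ(P(M))`. A chain of flats of `M'` is spanned by the members
of a chain of subsets of a single independent set; the closures in `M` of the preimages of these
sets form a chain of flats of the same ranks, which `φ` pushes forward to the given one. So every
flag of `M'` is the image of a flag of `M`: the maps `Φ_k(φ)`, and with them the Chow functors, are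
onto.

Eliminating the `y_e` presents both Chow rings by the variables `x_F` only. In this presentation the
monomials supported on a chain `F_1 < ⋯ < F_r`, with the exponent of `F_i` less than
`rk F_i - rk F_{i-1}` (and a different bound for `F_1`, which depends on the ring), form a basis.
They span because the relations push every other monomial into higher `rk`-weight; they are
independent by induction on the support, isolating the variable of a minimal flat. Lifting chains
from `M'` to `M` injects the basis for `M'` into the basis for `M`.
-/

namespace MatroidChow

section CoeffIdeal

open Polynomial

variable {S : Type*} [CommRing S] {I J : Ideal S}

/-- The ideal `(I ⊓ J) + X J + X² J + ⋯` of `S[X]`. It bounds the straightening ideals after the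
variable of a minimal flat is isolated. -/
noncomputable def coeffIdeal (I J : Ideal S) : Ideal S[X] := J.map C ⊓ I.comap constantCoeff

theorem mem_coeffIdeal {f : S[X]} :
    f ∈ coeffIdeal I J ↔ (∀ i, f.coeff i ∈ J) ∧ f.coeff 0 ∈ I := by
  rw [coeffIdeal, Ideal.mem_inf, Ideal.mem_map_C_iff, Ideal.mem_comap, constantCoeff_apply]

theorem C_mem_coeffIdeal (h : I ≤ J) {a : S} (ha : a ∈ I) : C a ∈ coeffIdeal I J :=
  ⟨Ideal.mem_map_of_mem C (h ha), by simpa using ha⟩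

theorem X_mul_C_mem_coeffIdeal {a : S} (ha : a ∈ J) : X * C a ∈ coeffIdeal I J :=
  ⟨Ideal.mul_mem_left _ _ (Ideal.mem_map_of_mem C ha), by simp⟩

theorem coeff_divByMonic_mem {p f : S[X]} (hp : p.Monic) (hf : ∀ i, f.coeff i ∈ J) (i : ℕ) :
    (f /ₘ p).coeff i ∈ J := by
  have hf0 : f.map (Ideal.Quotient.mk J) = 0 := by
    ext i
    simpa [Ideal.Quotient.eq_zero_iff_mem] using hf i
  have hq0 : (f /ₘ p).map (Ideal.Quotient.mk J) = 0 := by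
    rw [map_divByMonic _ hp, hf0, zero_divByMonic]
  rw [← Ideal.Quotient.eq_zero_iff_mem, ← coeff_map, hq0, coeff_zero]

/-- The quotient of `f` by `p` vanishes, so `f = g + q p` with `g` in `coeffIdeal I J` forces
`q = -(g /ₘ p)`, whose coefficients lie in `J`. -/
theorem mem_coeffIdeal_of_mem_sup_span {p : S[X]} (hp : p.Monic)
    (h0 : ∀ a ∈ J, a * p.coeff 0 ∈ I) {f : S[X]} (hf : f ∈ coeffIdeal I J ⊔ Ideal.span {p})
    (hdeg : f.degree < p.degree) : f ∈ coeffIdeal I J := by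
  nontriviality S
  obtain ⟨g, hg, _, hqp, rfl⟩ := Submodule.mem_sup.1 hf
  obtain ⟨q, rfl⟩ := Ideal.mem_span_singleton'.1 hqp
  rw [mem_coeffIdeal] at hg
  have hdiv : g /ₘ p + q = 0 := by
    refine (div_modByMonic_unique (g /ₘ p + q) (g %ₘ p) hp ⟨?_, degree_modByMonic_lt g hp⟩).1.symm
      |>.trans ((divByMonic_eq_zero_iff hp).2 hdeg)
    linear_combination modByMonic_add_div g p
  have hq : ∀ i, q.coeff i ∈ J := fun i => by
    rw [eq_neg_of_add_eq_zero_right hdiv, coeff_neg]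
    exact J.neg_mem (coeff_divByMonic_mem hp hg.1 i)
  refine mem_coeffIdeal.2 ⟨fun i => ?_, ?_⟩
  · rw [coeff_add, coeff_mul]
    exact J.add_mem (hg.1 i) (J.sum_mem fun k _ => J.mul_mem_right _ (hq k.1))
  · rw [coeff_add, mul_coeff_zero]
    exact I.add_mem hg.2 (h0 _ (hq 0))

end CoeffIdeal

section Isolate

open MvPolynomial

variable {σ R : Type*} [CommRing R]

open Classical in
/-- View a polynomial as a polynomial in the variable `F` alone, with coefficients in the ring of
all polynomials; the variable `F` does not occur in these coefficients. -/
noncomputable def isolate (R : Type*) [CommRing R] (F : σ) :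
    MvPolynomial σ R →ₐ[R] Polynomial (MvPolynomial σ R) :=
  aeval fun G => if G = F then Polynomial.X else Polynomial.C (X G)

theorem isolate_X_self (F : σ) : isolate R F (X F) = Polynomial.X := by
  simp [isolate]

theorem isolate_X_of_ne {F G : σ} (h : G ≠ F) : isolate R F (X G) = Polynomial.C (X G) := by
  simp [isolate, h]

theorem eval_isolate (F : σ) (f : MvPolynomial σ R) :
    (isolate R F f).eval (X F) = f := by
  have h : ((Polynomial.aeval (R := MvPolynomial σ R) (X F)).restrictScalars R).comp
      (isolate R F) = AlgHom.id R _ := by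
    ext1 G
    by_cases hG : G = F
    · simp [hG, isolate_X_self]
    · simp [isolate_X_of_ne hG]
  simpa using DFunLike.congr_fun h f

theorem isolate_monomial (F : σ) (m : σ →₀ ℕ) (c : R) :
    isolate R F (monomial m c) =
      Polynomial.C (monomial (m.erase F) c) * Polynomial.X ^ m F := by
  classical
  have herase : isolate R F (monomial (m.erase F) c) =
      Polynomial.C (monomial (m.erase F) c) := by
    rw [monomial_eq, Finsupp.prod, map_mul, map_prod, ← algebraMap_eq, AlgHom.commutes, map_mul,
      map_prod]
    congr 1
    refine Finset.prod_congr rfl fun G hG => ?_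
    rw [Finsupp.support_erase] at hG
    rw [map_pow, isolate_X_of_ne (Finset.ne_of_mem_erase hG), map_pow]
  nth_rw 1 [← m.erase_add_single F]
  rw [← mul_one c, ← monomial_mul, ← X_pow_eq_monomial, map_mul, map_pow, isolate_X_self,
    herase, mul_one]

theorem exists_of_mem_support_coeff_isolate {F : σ} {f : MvPolynomial σ R} {i : ℕ} {n : σ →₀ ℕ}
    (hn : n ∈ ((isolate R F f).coeff i).support) :
    ∃ m ∈ f.support, m F = i ∧ m.erase F = n := by
  classical
  have hcoeff : (isolate R F f).coeff i =
      ∑ m ∈ f.support, if m F = i then monomial (m.erase F) (f.coeff m) else 0 := by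
    conv_lhs => rw [f.as_sum, map_sum, Polynomial.finsetSum_coeff]
    simp only [isolate_monomial, Polynomial.coeff_C_mul_X_pow, eq_comm]
  rw [hcoeff] at hn
  obtain ⟨m, hm, hnm⟩ := Finset.mem_biUnion.1 (support_sum hn)
  split_ifs at hnm with hi
  · exact ⟨m, hm, hi, (Finset.mem_singleton.1 (support_monomial_subset hnm)).symm⟩
  · simp at hnm

end Isolate

section VarSum

open MvPolynomial

variable {σ R : Type*} [Finite σ] [CommRing R]

/-- The sum of the variables in a set `s`, which is meant to be finite (a `finsum` over an infinite
support is `0`). -/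
noncomputable def varSum {σ : Type*} (R : Type*) [CommRing R] (s : Set σ) : MvPolynomial σ R :=
  ∑ᶠ G ∈ s, X G

theorem varSum_singleton {σ : Type*} (G : σ) : varSum R {G} = X G :=
  finsum_mem_singleton

theorem isHomogeneous_varSum {σ : Type*} (s : Set σ) : (varSum R s).IsHomogeneous 1 :=
  finsum_mem_induction (fun p : MvPolynomial σ R => p.IsHomogeneous 1)
    (isHomogeneous_zero _ _ _) (fun _ _ hp hq => hp.add hq) fun G _ => isHomogeneous_X R G

theorem varSum_union {s t : Set σ} (h : Disjoint s t) :
    varSum R (s ∪ t) = varSum R s + varSum R t :=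
  finsum_mem_union h s.toFinite t.toFinite

theorem varSum_sub_varSum {s t : Set σ} (h : s ⊆ t) :
    varSum R t - varSum R s = varSum R (t \ s) := by
  rw [← Set.union_sdiff_cancel h, varSum_union Set.disjoint_sdiff_right, add_sub_cancel_left,
    Set.union_sdiff_cancel h]

theorem map_varSum {A F : Type*} [AddCommMonoid A] [FunLike F (MvPolynomial σ R) A]
    [AddMonoidHomClass F (MvPolynomial σ R) A] (g : F) (s : Set σ) :
    g (varSum R s) = ∑ᶠ G ∈ s, g (X G) :=
  (g : MvPolynomial σ R →+ A).map_finsum_mem _ s.toFinite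

theorem mul_varSum_mem {σ : Type*} {K : Ideal (MvPolynomial σ R)} {a : MvPolynomial σ R}
    {s : Set σ} (h : ∀ G ∈ s, a * X G ∈ K) : a * varSum R s ∈ K :=
  finsum_mem_induction (fun p => a * p ∈ K) (by simp)
    (fun p q hp hq => by simpa only [mul_add] using K.add_mem hp hq) h

theorem mul_varSum_pow_mem_iff {K : Ideal (MvPolynomial σ R)} {a : MvPolynomial σ R}
    {s t : Set σ} (hst : s ⊆ t) (h : ∀ G ∈ t \ s, a * X G ∈ K) (n : ℕ) :
    a * varSum R t ^ n ∈ K ↔ a * varSum R s ^ n ∈ K := by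
  obtain ⟨c, hc⟩ := sub_dvd_pow_sub_pow (varSum R t) (varSum R s) n
  have hmem : a * varSum R t ^ n - a * varSum R s ^ n ∈ K := by
    rw [← mul_sub, hc, ← mul_assoc, varSum_sub_varSum hst]
    exact K.mul_mem_right _ (mul_varSum_mem h)
  exact ⟨fun ht => (K.sub_mem_iff_right ht).1 hmem, fun hs => (K.sub_mem_iff_left hs).1 hmem⟩

theorem isolate_varSum {F : σ} {s : Set σ} (hF : F ∉ s) :
    isolate R F (varSum R s) = Polynomial.C (varSum R s) := by
  rw [map_varSum, map_varSum]
  exact finsum_mem_congr rfl fun G hG => isolate_X_of_ne (ne_of_mem_of_not_mem hG hF)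

end VarSum

section Independence

open MvPolynomial Set

variable {L R : Type*} [SemilatticeSup L] [CommRing R] {r b : L → ℕ} {P : Set L}
  {F G H : L}

/-- The sum of the variables of all elements above `H`: the linear form in terms of which the
relations of a Chow ring are written. -/
noncomputable abbrev upperSum (R : Type*) [CommRing R] (H : L) : MvPolynomial L R :=
  varSum R (Ici H)

/-- The relations by which a monomial over `L` is straightened, for a rank function `r`. They
confine it to a chain in `P`, bound the exponent of `H` by `b H`, and bound it by the rank jump
`r H - r G` if `G < H` occurs as well. Taking `P` smaller than `L` makes an induction possible. -/
inductive StraighteningRelation (R : Type*) [CommRing R] (r b : L → ℕ) (P : Set L) :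
    MvPolynomial L R → Prop
  | var {G : L} : G ∉ P → StraighteningRelation R r b P (X G)
  | incomp {G H : L} : ¬ G ≤ H → ¬ H ≤ G → StraighteningRelation R r b P (X G * X H)
  | pair {G H : L} : G < H →
      StraighteningRelation R r b P (X G * upperSum R H ^ (r H - r G))
  | pow {H : L} : H ∈ P → StraighteningRelation R r b P (upperSum R H ^ b H)

/-- The ideal generated by the straightening relations. -/
noncomputable def straighteningIdeal (R : Type*) [CommRing R] (r b : L → ℕ) (P : Set L) :
    Ideal (MvPolynomial L R) :=
  Ideal.span {p | StraighteningRelation R r b P p}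

/-- The exponents of the standard monomials, those to which no straightening relation applies. -/
structure IsStandard (r b : L → ℕ) (P : Set L) (m : L →₀ ℕ) : Prop where
  mem : ∀ {H}, m H ≠ 0 → H ∈ P
  chain : ∀ {G H}, m G ≠ 0 → m H ≠ 0 → G ≤ H ∨ H ≤ G
  lt : ∀ {H}, m H ≠ 0 → m H < b H
  lt_sub : ∀ {G H}, G < H → m G ≠ 0 → m H ≠ 0 → m H < r H - r G

/-- The conditions on the exponent bound `b` under which the standard monomials are linearly
independent modulo the straightening relations. -/
structure IsBound (r b : L → ℕ) (P : Set L) : Prop where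
  pos : ∀ {F}, F ∈ P → 0 < b F
  sup_le : ∀ {F G}, F ∈ P → G ∈ P → ¬ F ≤ G → r (G ⊔ F) ≤ b F + r G
  le_add : ∀ {F H}, F ∈ P → H ∈ P → F < H → b H + r F ≤ b F + r H

/-- A strictly monotone rank function that is submodular with respect to lower bounds, since `L`
need not have meets. -/
structure IsSubmodularRank (r : L → ℕ) : Prop where
  strictMono : StrictMono r
  submodular : ∀ {B F G}, B ≤ F → B ≤ G → r (F ⊔ G) + r B ≤ r F + r G

theorem StraighteningRelation.mem {p : MvPolynomial L R} (hp : StraighteningRelation R r b P p) :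
    p ∈ straighteningIdeal R r b P :=
  Ideal.subset_span hp

theorem straighteningIdeal_le {K : Ideal (MvPolynomial L R)} :
    straighteningIdeal R r b P ≤ K ↔ ∀ p, StraighteningRelation R r b P p → p ∈ K :=
  Ideal.span_le

theorem IsBound.mono {Q : Set L} (hb : IsBound r b P) (h : Q ⊆ P) : IsBound r b Q where
  pos hF := hb.pos (h hF)
  sup_le hF hG := hb.sup_le (h hF) (h hG)
  le_add hF hH := hb.le_add (h hF) (h hH)

theorem IsSubmodularRank.isBound_sub (hr : IsSubmodularRank r) (F : L) :
    IsBound r (fun H => r H - r F) (Ioi F) where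
  pos hG := Nat.sub_pos_of_lt (hr.strictMono hG)
  sup_le {G H} hG hH _ := by
    have := hr.submodular (le_of_lt hH) (le_of_lt hG)
    have := hr.strictMono hG
    omega
  le_add {G H} hG hH _ := by
    have := hr.strictMono hG
    have := hr.strictMono hH
    omega

theorem IsStandard.erase_of_eq_zero {m : L →₀ ℕ} (hm : IsStandard r b P m) (hF : m F = 0) :
    IsStandard r b (P \ {F}) (m.erase F) := by
  rw [Finsupp.erase_of_notMem_support (Finsupp.notMem_support_iff.2 hF)]
  exact ⟨fun hH => ⟨hm.mem hH, fun h => hH (h ▸ hF)⟩, hm.chain, hm.lt, hm.lt_sub⟩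

theorem IsStandard.erase_of_ne_zero {m : L →₀ ℕ} (hm : IsStandard r b P m)
    (hF : Minimal (· ∈ P) F) (hmF : m F ≠ 0) :
    IsStandard r (fun H => r H - r F) (Ioi F) (m.erase F) := by
  have herase {H} (hH : m.erase F H ≠ 0) : m H ≠ 0 ∧ m.erase F H = m H ∧ F < H := by
    have hne : H ≠ F := by rintro rfl; simp at hH
    rw [Finsupp.erase_ne hne] at hH ⊢
    refine ⟨hH, rfl, lt_of_le_of_ne ?_ hne.symm⟩
    exact (hm.chain hmF hH).elim id fun h => hF.le_of_le (hm.mem hH) h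
  constructor
  · exact fun hH => (herase hH).2.2
  · exact fun hG hH => hm.chain (herase hG).1 (herase hH).1
  · intro H hH
    obtain ⟨hH, heq, hFH⟩ := herase hH
    exact heq ▸ hm.lt_sub hFH hmF hH
  · intro G H hGH hG hH
    obtain ⟨hH, heq, -⟩ := herase hH
    exact heq ▸ hm.lt_sub hGH (herase hG).1 hH

theorem eq_zero_of_mem_straighteningIdeal_empty {f : MvPolynomial L R}
    (hf : f ∈ straighteningIdeal R r b ∅) (hstd : ∀ m ∈ f.support, IsStandard r b ∅ m) :
    f = 0 := by
  have hconst : straighteningIdeal R r b ∅ ≤ RingHom.ker constantCoeff := by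
    rw [straighteningIdeal_le]
    rintro _ (_ | _ | _ | hH)
    · simp
    · simp
    · simp
    · exact hH.elim
  ext m
  rw [coeff_zero, ← notMem_support_iff]
  intro hm
  obtain rfl : m = 0 := Finsupp.ext fun H => by_contra fun hH => (hstd m hm).mem hH
  exact mem_support_iff.1 hm (hconst hf)

theorem degree_isolate_lt {f : MvPolynomial L R} (hstd : ∀ m ∈ f.support, IsStandard r b P m)
    (hF : 0 < b F) : (isolate R F f).degree < b F := by
  rw [Polynomial.degree_lt_iff_coeff_zero]
  intro i hi
  by_contra hne
  obtain ⟨n, hn⟩ := support_nonempty.2 hne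
  obtain ⟨m, hm, rfl, -⟩ := exists_of_mem_support_coeff_isolate hn
  exact hi.not_gt ((hstd m hm).lt (hF.trans_le hi).ne')

variable [Finite L]

theorem upperSum_eq (F : L) : upperSum R F = X F + varSum R (Ioi F) := by
  rw [upperSum, ← Ioi_insert, insert_eq, varSum_union (by simp), varSum_singleton]

theorem isolate_upperSum_self (F : L) :
    isolate R F (upperSum R F) = Polynomial.X + Polynomial.C (varSum R (Ioi F)) := by
  rw [upperSum_eq, map_add, isolate_X_self, isolate_varSum self_notMem_Ioi]

theorem isolate_upperSum_of_not_le (h : ¬ H ≤ F) :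
    isolate R F (upperSum R H) = Polynomial.C (upperSum R H) :=
  isolate_varSum h

theorem X_mul_upperSum_pow_mem (h : ¬ F ≤ G) {n : ℕ} (hn : r (G ⊔ F) ≤ n + r G) :
    X G * upperSum R F ^ n ∈ straighteningIdeal R r b P := by
  rw [mul_varSum_pow_mem_iff (Ici_subset_Ici.2 (le_sup_right : F ≤ G ⊔ F))]
  · obtain ⟨k, rfl⟩ := Nat.exists_eq_add_of_le (Nat.sub_le_iff_le_add.2 hn)
    rw [pow_add, ← mul_assoc]
    exact Ideal.mul_mem_right _ _ (StraighteningRelation.pair (left_lt_sup.2 h)).mem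
  · rintro H ⟨hFH, hH⟩
    exact (StraighteningRelation.incomp (fun hGH => hH (sup_le hGH hFH))
      fun hHG => h (le_trans hFH hHG)).mem

theorem straighteningIdeal_diff_singleton_le (hP : IsUpperSet P) (hF : Minimal (· ∈ P) F)
    (hb : IsBound r b P) :
    straighteningIdeal R r b (P \ {F}) ≤
      straighteningIdeal R r (fun H => r H - r F) (Ioi F) := by
  rw [straighteningIdeal_le]
  rintro _ (hG | ⟨hGH, hHG⟩ | hGH | ⟨hHP, hHF⟩)
  · exact (StraighteningRelation.var fun h => hG ⟨hP (le_of_lt h) hF.prop, ne_of_gt h⟩).mem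
  · exact (StraighteningRelation.incomp hGH hHG).mem
  · exact (StraighteningRelation.pair hGH).mem
  · rename_i H
    have hle : ¬ H ≤ F := fun h => hHF (hF.eq_of_le hHP h)
    rw [← one_mul (_ ^ _), mul_varSum_pow_mem_iff (Ici_subset_Ici.2 (le_sup_right : H ≤ F ⊔ H)),
      one_mul]
    · refine Ideal.pow_mem_of_pow_mem _
        (StraighteningRelation.pow (left_lt_sup.2 hle : F ⊔ H ∈ Ioi F)).mem ?_
      exact Nat.sub_le_iff_le_add.2 (hb.sup_le hHP hF.prop hle)
    · rintro G ⟨hHG, hG⟩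
      rw [one_mul]
      exact (StraighteningRelation.var fun hFG => hG (sup_le (le_of_lt hFG) hHG)).mem

theorem X_mul_varSum_Ioi_pow_mem (hF : F ∈ P) (hb : IsBound r b P) (hG : G ∉ Ioi F) :
    X G * varSum R (Ioi F) ^ b F ∈ straighteningIdeal R r b (P \ {F}) := by
  by_cases hGP : G ∈ P \ {F}
  · have hle : ¬ F ≤ G := fun h => hG (lt_of_le_of_ne h (Ne.symm hGP.2))
    rw [← mul_varSum_pow_mem_iff Ioi_subset_Ici_self]
    · exact X_mul_upperSum_pow_mem hle (hb.sup_le hF hGP.1 hle)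
    · rintro H ⟨hFH, hH⟩
      obtain rfl : F = H := by_contra fun h => hH (lt_of_le_of_ne hFH h)
      exact Ideal.mul_mem_left _ _ (StraighteningRelation.var fun h => h.2 rfl).mem
  · exact Ideal.mul_mem_right _ _ (StraighteningRelation.var hGP).mem

theorem upperSum_pow_mul_varSum_Ioi_pow_mem (hr : IsSubmodularRank r) (hF : F ∈ P) (hH : H ∈ P)
    (hb : IsBound r b P) (hFH : F < H) :
    upperSum R H ^ (r H - r F) * varSum R (Ioi F) ^ b F ∈
      straighteningIdeal R r b (P \ {F}) := by
  have hlt := hr.strictMono hFH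
  rw [mul_varSum_pow_mem_iff (Ici_subset_Ioi.2 hFH), ← pow_add]
  · refine Ideal.pow_mem_of_pow_mem _
      (StraighteningRelation.pow (mem_sdiff_singleton.2 ⟨hH, ne_of_gt hFH⟩)).mem ?_
    have := hb.le_add hF hH hFH
    omega
  · rintro G ⟨hFG, hG⟩
    rw [mul_comm]
    refine X_mul_upperSum_pow_mem hG ?_
    have := hr.submodular (le_of_lt hFG) hFH.le
    omega

theorem mul_varSum_Ioi_pow_mem (hr : IsSubmodularRank r) (hP : IsUpperSet P) (hF : F ∈ P)
    (hb : IsBound r b P) {p : MvPolynomial L R}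
    (hp : p ∈ straighteningIdeal R r (fun H => r H - r F) (Ioi F)) :
    p * varSum R (Ioi F) ^ b F ∈ straighteningIdeal R r b (P \ {F}) := by
  suffices h : straighteningIdeal R r (fun H => r H - r F) (Ioi F) ≤
      (straighteningIdeal R r b (P \ {F})).colon {varSum R (Ioi F) ^ b F} from
    Submodule.mem_colon_singleton.1 (h hp)
  rw [straighteningIdeal_le]
  intro q hq
  rw [Submodule.mem_colon_singleton, smul_eq_mul]
  obtain hG | ⟨hGH, hHG⟩ | hGH | hH := hq
  · exact X_mul_varSum_Ioi_pow_mem hF hb hG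
  · exact Ideal.mul_mem_right _ _ (StraighteningRelation.incomp hGH hHG).mem
  · exact Ideal.mul_mem_right _ _ (StraighteningRelation.pair hGH).mem
  · exact upperSum_pow_mul_varSum_Ioi_pow_mem hr hF (hP (le_of_lt hH) hF) hb hH

theorem isolate_X_mul_X_mem (hP : IsUpperSet P) (hF : Minimal (· ∈ P) F) (hb : IsBound r b P)
    (hGH : ¬ G ≤ H) (hHG : ¬ H ≤ G) :
    isolate R F (X G * X H) ∈ coeffIdeal (straighteningIdeal R r b (P \ {F}))
      (straighteningIdeal R r (fun H => r H - r F) (Ioi F)) := by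
  have hX {K : L} (hK : ¬ F ≤ K) :
      (X K : MvPolynomial L R) ∈ straighteningIdeal R r (fun H => r H - r F) (Ioi F) :=
    (StraighteningRelation.var fun h : F < K => hK h.le).mem
  rw [map_mul]
  by_cases hGF : G = F
  · subst hGF
    rw [isolate_X_self, isolate_X_of_ne (ne_of_not_le hHG)]
    exact X_mul_C_mem_coeffIdeal (hX hGH)
  by_cases hHF : H = F
  · subst hHF
    rw [isolate_X_self, isolate_X_of_ne hGF, mul_comm]
    exact X_mul_C_mem_coeffIdeal (hX hHG)
  · rw [isolate_X_of_ne hGF, isolate_X_of_ne hHF, ← map_mul]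
    exact C_mem_coeffIdeal (straighteningIdeal_diff_singleton_le hP hF hb)
      (StraighteningRelation.incomp hGH hHG).mem

theorem isolate_X_mul_upperSum_pow_mem (hP : IsUpperSet P) (hF : Minimal (· ∈ P) F)
    (hb : IsBound r b P) (hGH : G < H) :
    isolate R F (X G * upperSum R H ^ (r H - r G)) ∈
      coeffIdeal (straighteningIdeal R r b (P \ {F}))
        (straighteningIdeal R r (fun H => r H - r F) (Ioi F)) := by
  have hle := straighteningIdeal_diff_singleton_le (R := R) hP hF hb
  rw [map_mul, map_pow]
  by_cases hHF : H ≤ F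
  · have hGF := lt_of_lt_of_le hGH hHF
    rw [isolate_X_of_ne hGF.ne]
    exact Ideal.mul_mem_right _ _
      (C_mem_coeffIdeal hle (StraighteningRelation.var fun h => hF.not_lt h.1 hGF).mem)
  rw [isolate_upperSum_of_not_le hHF, ← map_pow]
  by_cases hGF : G = F
  · subst hGF
    rw [isolate_X_self]
    exact X_mul_C_mem_coeffIdeal (StraighteningRelation.pow (mem_Ioi.2 hGH)).mem
  · rw [isolate_X_of_ne hGF, ← map_mul]
    exact C_mem_coeffIdeal hle (StraighteningRelation.pair hGH).mem

theorem isolate_mem (hP : IsUpperSet P) (hF : Minimal (· ∈ P) F) (hb : IsBound r b P)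
    {p : MvPolynomial L R} (hp : p ∈ straighteningIdeal R r b P) :
    isolate R F p ∈ coeffIdeal (straighteningIdeal R r b (P \ {F}))
        (straighteningIdeal R r (fun H => r H - r F) (Ioi F)) ⊔
      Ideal.span {(Polynomial.X + Polynomial.C (varSum R (Ioi F))) ^ b F} := by
  have hle := straighteningIdeal_diff_singleton_le (R := R) hP hF hb
  rw [← Ideal.mem_comap]
  refine straighteningIdeal_le.2 (fun q hq => Ideal.mem_comap.2 ?_) hp
  obtain @⟨G, hG⟩ | ⟨hGH, hHG⟩ | hGH | @⟨H, hH⟩ := hq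
  · rw [isolate_X_of_ne (ne_of_mem_of_not_mem hF.prop hG).symm]
    exact Ideal.mem_sup_left
      (C_mem_coeffIdeal hle (StraighteningRelation.var fun h => hG h.1).mem)
  · exact Ideal.mem_sup_left (isolate_X_mul_X_mem hP hF hb hGH hHG)
  · exact Ideal.mem_sup_left (isolate_X_mul_upperSum_pow_mem hP hF hb hGH)
  · rw [map_pow]
    by_cases hHF : H = F
    · subst hHF
      rw [isolate_upperSum_self]
      exact Ideal.mem_sup_right (Ideal.mem_span_singleton_self _)
    · rw [isolate_upperSum_of_not_le fun h => hHF (hF.eq_of_le hH h), ← map_pow]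
      exact Ideal.mem_sup_left (C_mem_coeffIdeal hle
        (StraighteningRelation.pow (mem_sdiff_singleton.2 ⟨hH, hHF⟩)).mem)

/-- Isolate the variable of a minimal element `F` of `P`: the relation at `F` becomes a monic
polynomial, and the other coefficients obey the relations for `P \ {F}` and `Ioi F`. -/
theorem eq_zero_of_mem_straighteningIdeal (hr : IsSubmodularRank r) (hP : IsUpperSet P)
    (hb : IsBound r b P) {f : MvPolynomial L R} (hf : f ∈ straighteningIdeal R r b P)
    (hstd : ∀ m ∈ f.support, IsStandard r b P m) : f = 0 := by
  nontriviality R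
  induction P using WellFoundedLT.induction generalizing b f with | _ P ih
  obtain rfl | hne := P.eq_empty_or_nonempty
  · exact eq_zero_of_mem_straighteningIdeal_empty hf hstd
  obtain ⟨F, hF⟩ := P.toFinite.exists_minimal hne
  have hmonic := (Polynomial.monic_X_add_C (varSum R (Ioi F))).pow (b F)
  have hdeg : (isolate R F f).degree <
      ((Polynomial.X + Polynomial.C (varSum R (Ioi F))) ^ b F).degree := by
    rw [Polynomial.degree_eq_natDegree hmonic.ne_zero, (Polynomial.monic_X_add_C _).natDegree_pow,
      Polynomial.natDegree_X_add_C, mul_one]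
    exact degree_isolate_lt hstd (hb.pos hF.prop)
  have hmem := mem_coeffIdeal.1 <| mem_coeffIdeal_of_mem_sup_span hmonic (fun p hp => by
    simpa [Polynomial.coeff_zero_eq_eval_zero] using mul_varSum_Ioi_pow_mem hr hP hF.prop hb hp)
    (isolate_mem hP hF hb hf) hdeg
  suffices h : isolate R F f = 0 by rw [← eval_isolate F f, h, Polynomial.eval_zero]
  ext1 i
  rw [Polynomial.coeff_zero]
  obtain rfl | hi := eq_or_ne i 0
  · refine ih (P \ {F}) (sdiff_singleton_ssubset.2 hF.prop)
      (hP.erase fun G hG h => hF.eq_of_le hG h) (hb.mono sdiff_subset) hmem.2 ?_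
    intro n hn
    obtain ⟨m, hm, hmF, rfl⟩ := exists_of_mem_support_coeff_isolate hn
    exact (hstd m hm).erase_of_eq_zero hmF
  · refine ih (Ioi F) ⟨fun G hG => hP (le_of_lt hG) hF.prop, fun h => self_notMem_Ioi (h hF.prop)⟩
      (isUpperSet_Ioi F) (hr.isBound_sub F) (hmem.1 i) ?_
    intro n hn
    obtain ⟨m, hm, rfl, rfl⟩ := exists_of_mem_support_coeff_isolate hn
    exact (hstd m hm).erase_of_ne_zero hF hi

end Independence

section Spanning

open MvPolynomial

/-- The polynomials all of whose monomials have degree `d` and `r`-weight at least `n`.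
Straightening a monomial moves it further down this filtration. -/
noncomputable def weightFiltration {σ : Type*} (R : Type*) [CommRing R] (r : σ → ℕ) (d n : ℕ) :
    Submodule R (MvPolynomial σ R) :=
  restrictSupport R {m | m.degree = d ∧ n ≤ Finsupp.weight r m}

section

variable {σ R : Type*} [CommRing R] {r : σ → ℕ} {d d' n n' : ℕ}

theorem weightFiltration_anti (h : n ≤ n') :
    weightFiltration R r d n' ≤ weightFiltration R r d n :=
  restrictSupport_mono _ fun _ hm => ⟨hm.1, h.trans hm.2⟩

theorem mul_mem_weightFiltration {p q : MvPolynomial σ R} (hp : p ∈ weightFiltration R r d n)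
    (hq : q ∈ weightFiltration R r d' n') :
    p * q ∈ weightFiltration R r (d + d') (n + n') := by
  refine restrictSupport_mono R ?_ ((restrictSupport_add R _ _).ge (Submodule.mul_mem_mul hp hq))
  rintro _ ⟨m, hm, m', hm', rfl⟩
  dsimp only
  rw [Set.mem_ofPred_eq, map_add, map_add, hm.1, hm'.1]
  exact ⟨rfl, add_le_add hm.2 hm'.2⟩

theorem monomial_mem_weightFiltration (m : σ →₀ ℕ) (c : R) :
    monomial m c ∈ weightFiltration R r m.degree (Finsupp.weight r m) :=
  (monomial_mem_restrictSupport R).2 (Or.inl ⟨rfl, le_rfl⟩)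

theorem homogeneousSubmodule_eq_weightFiltration (d : ℕ) :
    homogeneousSubmodule σ R d = weightFiltration R r d 0 := by
  ext p
  simp only [weightFiltration, mem_restrictSupport_iff, zero_le, and_true, mem_homogeneousSubmodule,
    IsHomogeneous, IsWeightedHomogeneous, Set.subset_def, Finset.mem_coe, mem_support_iff,
    Set.mem_ofPred_eq, Finsupp.degree_eq_weight_one, Pi.one_def]

theorem X_mem_weightFiltration (G : σ) :
    (X G : MvPolynomial σ R) ∈ weightFiltration R r 1 (r G) := by
  simpa [X, Finsupp.weight_single] using
    monomial_mem_weightFiltration (r := r) (fun₀ | G => 1) (1 : R)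

theorem exists_weightFiltration_eq_bot [Finite σ] (r : σ → ℕ) (d : ℕ) :
    ∃ n, weightFiltration R r d n = ⊥ := by
  obtain ⟨N, hN⟩ := Finite.exists_le r
  refine ⟨d * N + 1, eq_bot_iff.2 fun p hp => support_eq_empty.1 ?_⟩
  refine Finset.eq_empty_of_forall_notMem fun m hmp => ?_
  obtain ⟨rfl, hm⟩ := hp hmp
  have : Finsupp.weight r m ≤ m.degree * N := by
    rw [Finsupp.weight_apply, Finsupp.degree_apply, Finsupp.sum, Finset.sum_mul]
    exact Finset.sum_le_sum fun H _ => Nat.mul_le_mul_left _ (hN H)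
  omega

end

variable {L R : Type*} [SemilatticeSup L] [CommRing R] {r b : L → ℕ}

/-- The standard exponents of degree `d`, which index a basis of the degree `d` part of the quotient
by the straightening relations. -/
def standardExponents (r b : L → ℕ) (d : ℕ) : Set (L →₀ ℕ) :=
  {m | IsStandard r b Set.univ m ∧ m.degree = d}

theorem monomial_mul_mem_of_le {σ : Type*} {K : Ideal (MvPolynomial σ R)} {m n : σ →₀ ℕ}
    (h : n ≤ m) {p : MvPolynomial σ R} (hp : monomial n 1 * p ∈ K) : monomial m 1 * p ∈ K := by
  obtain ⟨k, rfl⟩ := exists_add_of_le h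
  rw [add_comm, ← mul_one (1 : R), ← monomial_mul, mul_assoc]
  exact K.mul_mem_left _ hp

theorem exists_monomial_mul_upperSum_pow_mem {m : L →₀ ℕ} (hm : ¬ IsStandard r b Set.univ m) :
    ∃ (n : L →₀ ℕ) (H : L) (e : ℕ), n + Finsupp.single H e = m ∧
      monomial n 1 * upperSum R H ^ e ∈ straighteningIdeal R r b Set.univ := by
  by_contra hcon
  have hnot {H : L} {e : ℕ} (he : e ≤ m H) : monomial (m - Finsupp.single H e) 1 *
      upperSum R H ^ e ∉ straighteningIdeal R r b Set.univ := fun h =>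
    hcon ⟨_, H, e, tsub_add_cancel_of_le (Finsupp.single_le_iff.2 he), h⟩
  refine hm ⟨fun _ => Set.mem_univ _, fun {G H} hG hH => ?_, fun {H} _ => ?_,
    fun {G H} hGH hG _ => ?_⟩
  · by_contra! h
    have hle : Finsupp.single G 1 + Finsupp.single H 1 ≤ m := by
      intro K
      have := ne_of_not_le h.1
      by_cases G = K <;> by_cases H = K <;> simp_all <;> omega
    refine hnot (zero_le : 0 ≤ m G) ?_
    rw [Finsupp.single_zero, tsub_zero, pow_zero]
    refine monomial_mul_mem_of_le hle ?_
    rw [mul_one, ← mul_one (1 : R), ← monomial_mul]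
    exact (StraighteningRelation.incomp h.1 h.2).mem
  · by_contra! hlt
    exact hnot hlt (Ideal.mul_mem_left _ _ (StraighteningRelation.pow (Set.mem_univ H)).mem)
  · by_contra! hlt
    refine hnot hlt (monomial_mul_mem_of_le (n := Finsupp.single G 1) ?_
      (StraighteningRelation.pair hGH).mem)
    rw [Finsupp.single_le_iff, Finsupp.tsub_apply, Finsupp.single_eq_of_ne hGH.ne]
    omega

variable [Finite L]

theorem X_sub_upperSum_mem_weightFiltration (hr : StrictMono r) (H : L) :
    X H - upperSum R H ∈ weightFiltration R r 1 (r H + 1) := by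
  rw [upperSum_eq, sub_add_cancel_left]
  exact neg_mem <| finsum_mem_induction _ (zero_mem _) (fun _ _ => add_mem) fun G hG =>
    weightFiltration_anti (hr hG) (X_mem_weightFiltration G)

theorem upperSum_mem_weightFiltration (hr : StrictMono r) (H : L) :
    upperSum R H ∈ weightFiltration R r 1 (r H) := by
  rw [← sub_sub_cancel (X H) (upperSum R H)]
  exact sub_mem (X_mem_weightFiltration H)
    (weightFiltration_anti (Nat.le_succ _) (X_sub_upperSum_mem_weightFiltration hr H))

theorem X_pow_sub_upperSum_pow_mem_weightFiltration (hr : StrictMono r) (H : L) (e : ℕ) :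
    X H ^ e - upperSum R H ^ e ∈ weightFiltration R r e (e * r H + 1) := by
  induction e with
  | zero => simp
  | succ e ih =>
    have hX : (X H ^ e : MvPolynomial L R) ∈ weightFiltration R r e (e * r H) := by
      simpa [X_pow_eq_monomial, Finsupp.weight_single] using
        monomial_mem_weightFiltration (r := r) (fun₀ | H => e) (1 : R)
    have hsplit : (X H ^ (e + 1) - upperSum R H ^ (e + 1) : MvPolynomial L R) =
        X H ^ e * (X H - upperSum R H) + (X H ^ e - upperSum R H ^ e) * upperSum R H := by
      ring
    rw [hsplit, add_mul, one_mul]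
    refine add_mem ?_ ?_
    · exact add_assoc (e * r H) _ _ ▸
        mul_mem_weightFiltration hX (X_sub_upperSum_mem_weightFiltration hr H)
    · exact weightFiltration_anti (by omega)
        (mul_mem_weightFiltration ih (upperSum_mem_weightFiltration hr H))

theorem monomial_mem_weightFiltration_sup (hr : StrictMono r) {m : L →₀ ℕ}
    (hm : ¬ IsStandard r b Set.univ m) :
    monomial m 1 ∈ weightFiltration R r m.degree (Finsupp.weight r m + 1) ⊔
      (straighteningIdeal R r b Set.univ).restrictScalars R := by
  obtain ⟨n, H, e, rfl, hmem⟩ := exists_monomial_mul_upperSum_pow_mem (R := R) hm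
  have hsplit : (monomial (n + Finsupp.single H e) 1 : MvPolynomial L R) =
      monomial n 1 * (X H ^ e - upperSum R H ^ e) + monomial n 1 * upperSum R H ^ e := by
    rw [← mul_add, sub_add_cancel, X_pow_eq_monomial, monomial_mul, mul_one]
  rw [hsplit, map_add, map_add, Finsupp.degree_single, Finsupp.weight_single, smul_eq_mul,
    add_assoc]
  exact Submodule.add_mem_sup (mul_mem_weightFiltration (monomial_mem_weightFiltration n 1)
    (X_pow_sub_upperSum_pow_mem_weightFiltration hr H e)) hmem

theorem homogeneousSubmodule_le_sup (hr : StrictMono r) (d : ℕ) :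
    homogeneousSubmodule L R d ≤ restrictSupport R (standardExponents r b d) ⊔
      (straighteningIdeal R r b Set.univ).restrictScalars R := by
  obtain ⟨N, hN⟩ := exists_weightFiltration_eq_bot (R := R) r d
  rw [homogeneousSubmodule_eq_weightFiltration (r := r)]
  refine Nat.decreasingInduction (motive := fun n _ => weightFiltration R r d n ≤ _)
    (fun n _ ih => ?_) (hN.trans_le bot_le) (zero_le : 0 ≤ N)
  rw [weightFiltration, restrictSupport_eq_span, Submodule.span_le]
  rintro _ ⟨m, ⟨rfl, hm⟩, rfl⟩
  by_cases hstd : IsStandard r b Set.univ m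
  · exact Submodule.mem_sup_left ((monomial_mem_restrictSupport R).2 (Or.inl ⟨hstd, rfl⟩))
  · refine sup_le ((weightFiltration_anti ?_).trans ih) le_sup_right
      (monomial_mem_weightFiltration_sup hr hstd)
    omega

end Spanning

section Dimension

open MvPolynomial

variable {L R : Type*} [SemilatticeSup L] [Finite L] [CommRing R] {r b : L → ℕ}

theorem disjoint_restrictSupport_straighteningIdeal (hr : IsSubmodularRank r)
    (hb : IsBound r b Set.univ) (d : ℕ) :
    Disjoint (restrictSupport R (standardExponents r b d))
      ((straighteningIdeal R r b Set.univ).restrictScalars R) :=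
  Submodule.disjoint_def.2 fun _ hstd hf =>
    eq_zero_of_mem_straighteningIdeal hr isUpperSet_univ hb hf fun _ hm => (hstd hm).1

theorem finrank_map_homogeneousSubmodule [Nontrivial R] {A : Type*} [CommRing A] [Algebra R A]
    (hr : IsSubmodularRank r) (hb : IsBound r b Set.univ) {q : MvPolynomial L R →ₐ[R] A}
    (hq : RingHom.ker q = straighteningIdeal R r b Set.univ) (d : ℕ) :
    Module.finrank R ((homogeneousSubmodule L R d).map q.toLinearMap) =
      (standardExponents r b d).ncard := by
  have hker : LinearMap.ker q.toLinearMap =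
      (straighteningIdeal R r b Set.univ).restrictScalars R := by
    rw [← hq]
    rfl
  have hmap : (homogeneousSubmodule L R d).map q.toLinearMap =
      (restrictSupport R (standardExponents r b d)).map q.toLinearMap := by
    refine le_antisymm ?_ (Submodule.map_mono ?_)
    · refine (Submodule.map_mono (homogeneousSubmodule_le_sup (b := b) hr.strictMono d)).trans ?_
      rw [Submodule.map_sup, ← hker, LinearMap.le_ker_iff_map.1 le_rfl, sup_bot_eq]
    · rw [homogeneousSubmodule_eq_weightFiltration (r := r)]
      exact restrictSupport_mono R fun m hm => ⟨hm.2, zero_le⟩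
  have hinj : Function.Injective
      (q.toLinearMap.domRestrict (restrictSupport R (standardExponents r b d))) := by
    rw [LinearMap.injective_domRestrict_iff, hker]
    exact disjoint_restrictSupport_straighteningIdeal hr hb d
  rw [hmap, ← LinearMap.range_domRestrict, LinearMap.finrank_range_of_inj hinj,
    Module.finrank_eq_nat_card_basis (basisRestrictSupport R _), Nat.card_coe_set_eq]

theorem finrank_map_homogeneousSubmodule_sum [Nontrivial R] {E A : Type*} [CommRing A]
    [Algebra R A] (hr : IsSubmodularRank r) (hb : IsBound r b Set.univ)
    {l : E → MvPolynomial L R} (hl : ∀ e, (l e).IsHomogeneous 1)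
    {q : MvPolynomial (L ⊕ E) R →ₐ[R] A}
    (hq : RingHom.ker q = (straighteningIdeal R r b Set.univ).comap (aeval (Sum.elim X l)))
    (d : ℕ) :
    Module.finrank R ((homogeneousSubmodule (L ⊕ E) R d).map q.toLinearMap) =
      (standardExponents r b d).ncard := by
  have hinl (p : MvPolynomial L R) : aeval (Sum.elim X l) (rename Sum.inl p) = p := by
    rw [aeval_rename, Sum.elim_comp_inl, aeval_X_left_apply]
  have hker : RingHom.ker (q.comp (rename Sum.inl)) = straighteningIdeal R r b Set.univ := by
    ext p
    rw [RingHom.mem_ker, AlgHom.comp_apply, ← RingHom.mem_ker, hq, Ideal.mem_comap, hinl]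
  have helim (p : MvPolynomial (L ⊕ E) R) :
      q p = q.comp (rename Sum.inl) (aeval (Sum.elim X l) p) := by
    refine sub_eq_zero.1 ((map_sub q _ _).symm.trans ?_)
    rw [← RingHom.mem_ker, hq, Ideal.mem_comap, map_sub]
    exact (sub_eq_zero.2 (hinl _).symm) ▸ zero_mem _
  have hmap : (homogeneousSubmodule (L ⊕ E) R d).map q.toLinearMap =
      (homogeneousSubmodule L R d).map (q.comp (rename Sum.inl)).toLinearMap := by
    refine le_antisymm ?_ ?_
    · rintro _ ⟨p, hp, rfl⟩
      refine ⟨_, ?_, (helim p).symm⟩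
      rw [SetLike.mem_coe, mem_homogeneousSubmodule, ← one_mul d]
      exact IsHomogeneous.aeval hp _ (Sum.rec (isHomogeneous_X R) hl)
    · rintro _ ⟨p, hp, rfl⟩
      exact ⟨_, IsHomogeneous.rename_isHomogeneous hp, rfl⟩
  rw [hmap, finrank_map_homogeneousSubmodule hr hb hker]

end Dimension

section Geometric

open MvPolynomial Set

variable {L R : Type*} [SemilatticeSup L] [OrderBot L] [CommRing R] {r b : L → ℕ} {a F G H : L}

/-- The rank function of a geometric lattice, given by its join and its bottom element only. -/
structure IsGeometricRank (r : L → ℕ) : Prop extends IsSubmodularRank r where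
  bot : r ⊥ = 0
  exists_atom : ∀ {G H}, ¬ H ≤ G → ∃ a ≤ H, r a = 1 ∧ ¬ a ≤ G

/-- The relations of the augmented Chow ring, after the variables of the ground set have been
eliminated: that of an element `e` is `upperSum R ⊥ - upperSum R a` for the atom `a` it spans. -/
structure IsChowIdeal (r : L → ℕ) (K : Ideal (MvPolynomial L R)) : Prop where
  incomp : ∀ {G H}, ¬ G ≤ H → ¬ H ≤ G → X G * X H ∈ K
  atom : ∀ {a F}, r a = 1 → ¬ a ≤ F → X F * upperSum R a ∈ K
  bot : upperSum R ⊥ ∈ K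

theorem IsSubmodularRank.sup_le_add (hr : IsSubmodularRank r) (F G : L) :
    r (F ⊔ G) ≤ r F + r G :=
  le_of_add_le_left (hr.submodular bot_le bot_le)

theorem IsSubmodularRank.isBound_succ (hr : IsSubmodularRank r) :
    IsBound r (fun F => r F + 1) univ where
  pos _ := Nat.succ_pos _
  sup_le {F G} _ _ _ := by
    have := hr.sup_le_add G F
    omega
  le_add _ _ _ := by omega

theorem IsSubmodularRank.isBound_max (hr : IsSubmodularRank r) :
    IsBound r (fun F => max 1 (r F)) univ where
  pos _ := lt_max_of_lt_left one_pos
  sup_le {F G} _ _ _ := by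
    have := hr.sup_le_add G F
    omega
  le_add _ _ h := by
    have := hr.strictMono h
    omega

theorem IsGeometricRank.sup_atom (hr : IsGeometricRank r) (ha : r a = 1) (haG : ¬ a ≤ G) :
    r (G ⊔ a) = r G + 1 :=
  le_antisymm (ha ▸ hr.sup_le_add G a) (hr.strictMono (left_lt_sup.2 haG))

variable [Finite L]

theorem isChowIdeal_straighteningIdeal (hr : IsSubmodularRank r) (hb : b ⊥ = 1) :
    IsChowIdeal r (straighteningIdeal R r b univ) where
  incomp hGH hHG := (StraighteningRelation.incomp hGH hHG).mem
  atom {a F} ha haF := by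
    rw [← pow_one (upperSum R a)]
    exact X_mul_upperSum_pow_mem haF (add_comm (r F) 1 ▸ ha ▸ hr.sup_le_add F a)
  bot := by
    rw [← pow_one (upperSum R ⊥), ← hb]
    exact (StraighteningRelation.pow (mem_univ ⊥)).mem

namespace IsChowIdeal

variable {K : Ideal (MvPolynomial L R)}

theorem X_mul_upperSum_sup_mem (hK : IsChowIdeal r K) (ha : r a = 1) (haF : ¬ a ≤ F)
    (hHF : H ≤ F) : X F * upperSum R (H ⊔ a) ∈ K := by
  rw [← pow_one (upperSum R _), ← mul_varSum_pow_mem_iff (Ici_subset_Ici.2 le_sup_right), pow_one]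
  · exact hK.atom ha haF
  · rintro G ⟨haG, hG⟩
    exact hK.incomp (fun hFG => hG (sup_le (hHF.trans hFG) haG))
      fun hGF => haF (le_trans haG hGF)

theorem mul_upperSum_sup_pow_succ_mem (hK : IsChowIdeal r K) (ha : r a = 1)
    {p : MvPolynomial L R} {n : ℕ} (hp : p * upperSum R H ^ n ∈ K) :
    p * upperSum R (H ⊔ a) ^ (n + 1) ∈ K := by
  rw [pow_succ', ← mul_assoc, ← mul_varSum_pow_mem_iff (Ici_subset_Ici.2 le_sup_left),
    mul_right_comm]
  · exact K.mul_mem_right _ hp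
  · rintro F ⟨hHF, hF⟩
    rw [mul_assoc, mul_comm (upperSum R _)]
    exact K.mul_mem_left _ (hK.X_mul_upperSum_sup_mem ha (fun h => hF (sup_le hHF h)) hHF)

theorem mul_upperSum_pow_mem_of_le (hK : IsChowIdeal r K) (hr : IsGeometricRank r)
    {p : MvPolynomial L R} {n : ℕ} (hp : p * upperSum R G ^ n ∈ K) (hGH : G ≤ H) :
    p * upperSum R H ^ (n + (r H - r G)) ∈ K := by
  induction G using WellFoundedGT.induction generalizing n with | _ G ih
  obtain rfl | hlt := hGH.eq_or_lt
  · rwa [Nat.sub_self, add_zero]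
  obtain ⟨a, haH, ha, haG⟩ := hr.exists_atom hlt.not_ge
  have hle : G ⊔ a ≤ H := sup_le hGH haH
  have hmem := ih _ (left_lt_sup.2 haG) (hK.mul_upperSum_sup_pow_succ_mem ha hp) hle
  have hrank := hr.sup_atom ha haG
  have := hr.strictMono.monotone hle
  rwa [show n + 1 + (r H - r (G ⊔ a)) = n + (r H - r G) by omega] at hmem

theorem X_mul_upperSum_pow_mem (hK : IsChowIdeal r K) (hr : IsGeometricRank r) (hGH : G < H) :
    X G * upperSum R H ^ (r H - r G) ∈ K := by
  obtain ⟨a, haH, ha, haG⟩ := hr.exists_atom hGH.not_ge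
  have hle : G ⊔ a ≤ H := sup_le hGH.le haH
  have hmem := hK.mul_upperSum_pow_mem_of_le hr (n := 1)
    ((pow_one (upperSum R (G ⊔ a))).symm ▸ hK.X_mul_upperSum_sup_mem ha haG le_rfl) hle
  have hrank := hr.sup_atom ha haG
  have := hr.strictMono.monotone hle
  rwa [show 1 + (r H - r (G ⊔ a)) = r H - r G by omega] at hmem

theorem upperSum_pow_mem_of_le (hK : IsChowIdeal r K) (hr : IsGeometricRank r)
    (hG : upperSum R G ∈ K) (hGH : G ≤ H) : upperSum R H ^ (1 + (r H - r G)) ∈ K := by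
  simpa using hK.mul_upperSum_pow_mem_of_le hr (p := 1) (n := 1) (by simpa using hG) hGH

theorem straighteningIdeal_le (hK : IsChowIdeal r K) (hr : IsGeometricRank r)
    (hpow : ∀ H, upperSum R H ^ b H ∈ K) : straighteningIdeal R r b univ ≤ K := by
  rw [MatroidChow.straighteningIdeal_le]
  rintro _ (hG | ⟨hGH, hHG⟩ | hGH | _)
  · exact absurd (mem_univ _) hG
  · exact hK.incomp hGH hHG
  · exact hK.X_mul_upperSum_pow_mem hr hGH
  · exact hpow _

theorem straighteningIdeal_succ_le (hK : IsChowIdeal r K) (hr : IsGeometricRank r) :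
    straighteningIdeal R r (fun H => r H + 1) univ ≤ K :=
  hK.straighteningIdeal_le hr fun H => by
    simpa [hr.bot, add_comm] using hK.upperSum_pow_mem_of_le hr hK.bot (bot_le : ⊥ ≤ H)

theorem straighteningIdeal_max_le (hK : IsChowIdeal r K) (hr : IsGeometricRank r)
    (hatom : ∀ a, r a = 1 → upperSum R a ∈ K) :
    straighteningIdeal R r (fun H => max 1 (r H)) univ ≤ K := by
  refine hK.straighteningIdeal_le hr fun H => ?_
  obtain rfl | hH := eq_or_ne H ⊥
  · simpa [hr.bot] using hK.bot
  obtain ⟨a, haH, ha, -⟩ := hr.exists_atom fun h => hH (le_bot_iff.1 h)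
  have hle := hr.strictMono.monotone haH
  have hmem := hK.upperSum_pow_mem_of_le hr (hatom a ha) haH
  rwa [show 1 + (r H - r a) = max 1 (r H) by omega] at hmem

end IsChowIdeal

end Geometric

section Transfer

variable {L L' : Type*} [SemilatticeSup L] [SemilatticeSup L'] {r b : L → ℕ} {r' b' : L' → ℕ}

theorem IsStandard.mapDomain {m : L' →₀ ℕ} (hm : IsStandard r' b' Set.univ m) {lift : L' →o L}
    (hinj : Set.InjOn lift m.support) (hr : ∀ F ∈ m.support, r (lift F) = r' F)
    (hb : ∀ F ∈ m.support, b (lift F) = b' F) :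
    IsStandard r b Set.univ (m.mapDomain lift) := by
  classical
  have happly {F} (hF : F ∈ m.support) : m.mapDomain lift (lift F) = m F :=
    Finsupp.mapDomain_apply' _ m Set.Subset.rfl hinj hF
  have hlift {H} (hH : m.mapDomain lift H ≠ 0) : ∃ F ∈ m.support, lift F = H :=
    Finset.mem_image.1 (Finsupp.mapDomain_support (Finsupp.mem_support_iff.2 hH))
  have hne {F} (hF : F ∈ m.support) : m F ≠ 0 := Finsupp.mem_support_iff.1 hF
  refine ⟨fun _ => Set.mem_univ _, fun hG hH => ?_, fun hH => ?_, fun hGH hG hH => ?_⟩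
  · obtain ⟨⟨G, hGm, rfl⟩, ⟨H, hHm, rfl⟩⟩ := And.intro (hlift hG) (hlift hH)
    exact (hm.chain (hne hGm) (hne hHm)).imp (lift.monotone ·) (lift.monotone ·)
  · obtain ⟨H, hHm, rfl⟩ := hlift hH
    rw [happly hHm, hb H hHm]
    exact hm.lt (hne hHm)
  · obtain ⟨⟨G, hGm, rfl⟩, ⟨H, hHm, rfl⟩⟩ := And.intro (hlift hG) (hlift hH)
    rw [happly hHm, hr H hHm, hr G hGm]
    refine hm.lt_sub ?_ (hne hGm) (hne hHm)
    refine lt_of_le_not_ge ?_ fun h => hGH.not_ge (lift.monotone h)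
    exact (hm.chain (hne hGm) (hne hHm)).resolve_right fun h => hGH.not_ge (lift.monotone h)

variable [Finite L]

theorem standardExponents_finite (r b : L → ℕ) (d : ℕ) : (standardExponents r b d).Finite :=
  (Finsupp.finite_of_degree_le d).subset fun _ hm => hm.2.le

theorem standardExponents_eq_empty (r b : L → ℕ) : ∃ N, ∀ d > N, standardExponents r b d = ∅ := by
  cases nonempty_fintype L
  refine ⟨∑ F, b F, fun d hd => Set.eq_empty_of_forall_notMem ?_⟩
  rintro m ⟨hm, rfl⟩
  rw [gt_iff_lt, Finsupp.degree_eq_sum] at hd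
  refine hd.not_ge (Finset.sum_le_sum fun F _ => ?_)
  obtain hF | hF := eq_or_ne (m F) 0
  · exact hF ▸ zero_le
  · exact (hm.lt hF).le

theorem ncard_standardExponents_le {push : L → L'}
    (hpush : ∀ C : Set L', C.Finite → IsChain (· ≤ ·) C → ∃ lift : L' →o L,
      ∀ F ∈ C, r (lift F) = r' F ∧ b (lift F) = b' F ∧ push (lift F) = F) (d : ℕ) :
    (standardExponents r' b' d).ncard ≤ (standardExponents r b d).ncard := by
  have hfin := standardExponents_finite r b d
  refine (Set.ncard_le_ncard ?_ (hfin.image (Finsupp.mapDomain push))).trans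
    (Set.ncard_image_le hfin)
  rintro m ⟨hm, hd⟩
  obtain ⟨lift, hlift⟩ := hpush m.support m.support.finite_toSet fun G hG H hH _ =>
    hm.chain (Finsupp.mem_support_iff.1 hG) (Finsupp.mem_support_iff.1 hH)
  have hinj : Set.InjOn lift m.support :=
    Set.LeftInvOn.injOn (f₁' := push) fun F hF => (hlift F hF).2.2
  refine ⟨m.mapDomain lift, ⟨hm.mapDomain hinj (fun F hF => (hlift F hF).1)
    fun F hF => (hlift F hF).2.1, ?_⟩, ?_⟩
  · rw [Finsupp.degree_mapDomain, hd]
  · rw [← Finsupp.mapDomain_comp]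
    exact (Finsupp.mapDomain_congr fun F hF => (hlift F hF).2.2).trans Finsupp.mapDomain_id

end Transfer

section Flats

open Set

variable {E : Type*} {M : Matroid E} {e : E} {F : Flat M}

/-- The join of two flats is the flat that they span. -/
instance : SemilatticeSup (Flat M) where
  sup F G := ⟨M.closure (F.1 ∪ G.1), M.isFlat_closure _⟩
  le_sup_left F G := subset_union_left.trans
    (M.subset_closure _ (union_subset F.2.subset_ground G.2.subset_ground))
  le_sup_right F G := subset_union_right.trans
    (M.subset_closure _ (union_subset F.2.subset_ground G.2.subset_ground))
  sup_le _ _ H hF hG := (M.closure_subset_closure (union_subset hF hG)).trans H.2.closure.subset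

/-- The least flat is the set of loops. -/
instance : OrderBot (Flat M) where
  bot := ⟨M.closure ∅, M.isFlat_closure _⟩
  bot_le F := (M.closure_subset_closure (empty_subset F.1)).trans F.2.closure.subset

/-- The rank of a flat, as a natural number. It is only used when this rank is finite. -/
noncomputable def flatRank (F : Flat M) : ℕ := (M.eRk F.1).toNat

/-- The flat spanned by an element. -/
def pointFlat (M : Matroid E) (e : E) : Flat M := ⟨M.closure {e}, M.isFlat_closure _⟩

theorem pointFlat_le_iff (he : e ∈ M.E) : pointFlat M e ≤ F ↔ e ∈ F.1 :=
  ⟨fun h => h (M.mem_closure_of_mem' (mem_singleton e) he), fun h =>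
    (M.closure_subset_closure (singleton_subset_iff.2 h)).trans F.2.closure.subset⟩

theorem flatRank_pointFlat_le_one (M : Matroid E) (e : E) : flatRank (pointFlat M e) ≤ 1 :=
  ENat.toNat_le_of_le_natCast ((M.eRk_closure_eq {e}).trans_le (M.eRk_singleton_le e))

theorem flatRank_pointFlat (he : M.IsNonloop e) : flatRank (pointFlat M e) = 1 := by
  rw [flatRank, pointFlat, Matroid.eRk_closure_eq, he.eRk_eq, ENat.toNat_one]

theorem coe_flatRank [M.RankFinite] (F : Flat M) : (flatRank F : ℕ∞) = M.eRk F.1 :=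
  ENat.natCast_toNat (Matroid.eRk_ne_top_iff.2 (M.isRkFinite_set F.1))

theorem exists_pointFlat_eq [M.RankFinite] (hF : flatRank F = 1) : ∃ e, pointFlat M e = F := by
  have hrank : M.eRk F.1 = 1 := by rw [← coe_flatRank, hF, Nat.cast_one]
  obtain ⟨e, heF, he, hle⟩ := (Matroid.eRk_eq_one_iff F.2.subset_ground).1 hrank
  exact ⟨e, le_antisymm ((pointFlat_le_iff he.mem_ground).2 heF) hle⟩

theorem flatRank_strictMono [M.RankFinite] : StrictMono (flatRank : Flat M → ℕ) := by
  intro F G hFG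
  by_contra! hle
  rw [← Nat.cast_le (α := ℕ∞), coe_flatRank, coe_flatRank] at hle
  have hcl := (M.isRkFinite_set F.1).closure_eq_closure_of_subset_of_eRk_ge_eRk hFG.le hle
  rw [F.2.closure, G.2.closure] at hcl
  exact hFG.ne (Subtype.ext hcl)

theorem isGeometricRank_flatRank [M.RankFinite] : IsGeometricRank (flatRank : Flat M → ℕ) where
  strictMono := flatRank_strictMono
  submodular {B F G} hBF hBG := by
    rw [← Nat.cast_le (α := ℕ∞), Nat.cast_add, Nat.cast_add]
    simp only [coe_flatRank]
    calc M.eRk (M.closure (F.1 ∪ G.1)) + M.eRk B.1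
        = M.eRk B.1 + M.eRk (F.1 ∪ G.1) := by rw [Matroid.eRk_closure_eq, add_comm]
      _ ≤ M.eRk (F.1 ∩ G.1) + M.eRk (F.1 ∪ G.1) := by
          gcongr
          exact M.eRk_mono (subset_inter hBF hBG)
      _ ≤ M.eRk F.1 + M.eRk G.1 := M.eRk_inter_add_eRk_union_le F.1 G.1
  bot := by
    rw [flatRank, ENat.toNat_eq_zero]
    exact Or.inl ((M.eRk_closure_eq ∅).trans M.eRk_empty)
  exists_atom {G H} hHG := by
    obtain ⟨e, heH, heG⟩ := not_subset.1 hHG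
    have he : e ∈ M.E := H.2.subset_ground heH
    have hloop : ¬ M.IsLoop e := fun h => heG (h.mem_of_isFlat G.2)
    exact ⟨pointFlat M e, (pointFlat_le_iff he).2 heH,
      flatRank_pointFlat ((M.not_isLoop_iff he).1 hloop), fun h => heG ((pointFlat_le_iff he).1 h)⟩

theorem rankFinite_of_finite_flat [Finite (Flat M)] : M.RankFinite := by
  obtain ⟨B, hB⟩ := M.exists_isBase
  have hinj : InjOn (pointFlat M) B := by
    intro e he f hf hef
    have hmem : e ∈ M.closure {f} :=
      (pointFlat_le_iff (F := pointFlat M f) (hB.subset_ground he)).1 hef.le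
    by_contra hne
    have hf' : {f} ⊆ B \ {e} := singleton_subset_iff.2 ⟨hf, Ne.symm hne⟩
    exact hB.indep.notMem_closure_sdiff_of_mem he (M.closure_subset_closure hf' hmem)
  exact ⟨B, hB, Finite.of_injOn (mapsTo_univ _ _) hinj finite_univ⟩

end Flats

section WeakMaps

open Set

variable {E E' : Type*} {M : Matroid E} {M' : Matroid E'} {φ : E ≃ E'}

theorem basePolytope_subset_unitCube (M : Matroid E) :
    basePolytope M ⊆ univ.pi fun _ => Icc (0 : ℝ) 1 := by
  refine convexHull_min ?_ (convex_pi fun _ _ => convex_Icc 0 1)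
  rintro _ ⟨B, -, rfl⟩ e -
  exact ⟨indicator_nonneg (fun _ _ => zero_le_one) e,
    indicator_le' (fun _ _ => le_rfl) (fun _ _ => zero_le_one) e⟩

/-- Indicator vectors are extreme points of the unit cube, hence of any polytope inside it. -/
theorem isBase_of_indicator_mem_basePolytope {S : Set E} (hS : S.indicator 1 ∈ basePolytope M) :
    M.IsBase S := by
  have hext : S.indicator 1 ∈ (univ.pi fun _ : E => Icc (0 : ℝ) 1).extremePoints ℝ := by
    rw [extremePoints_pi]
    intro e _
    rw [extremePoints_Icc zero_le_one]
    exact (indicator_eq_zero_or_self S 1 e)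
  obtain ⟨B, hB, hSB⟩ := extremePoints_convexHull_subset
    (inter_extremePoints_subset_extremePoints_of_subset (basePolytope_subset_unitCube M) ⟨hS, hext⟩)
  rwa [indicator_one_inj _ hSB]

namespace IsWeakMap

theorem isBase_preimage (hφ : IsWeakMap φ M M') {B : Set E'} (hB : M'.IsBase B) :
    M.IsBase (φ ⁻¹' B) := by
  obtain ⟨p, hp, hpB⟩ := hφ (subset_convexHull ℝ _ ⟨B, hB, rfl⟩)
  have hpre : (φ ⁻¹' B).indicator 1 = p := by
    ext e
    have he : p (φ.symm (φ e)) = B.indicator 1 (φ e) := congrFun hpB (φ e)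
    rw [← φ.symm_apply_apply e, he, φ.symm_apply_apply]
    rfl
  exact isBase_of_indicator_mem_basePolytope (hpre ▸ hp)

theorem indep_preimage (hφ : IsWeakMap φ M M') {I : Set E'} (hI : M'.Indep I) :
    M.Indep (φ ⁻¹' I) := by
  obtain ⟨B, hB, hIB⟩ := hI.exists_isBase_superset
  exact (hφ.isBase_preimage hB).indep.subset (preimage_mono hIB)

theorem eRk_image_le (hφ : IsWeakMap φ M M') (S : Set E) : M'.eRk (φ '' S) ≤ M.eRk S := by
  rw [Matroid.eRk_le_iff]
  intro I hIS hI
  rw [← encard_preimage_of_bijective φ.bijective I]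
  exact (hφ.indep_preimage hI).encard_le_eRk_of_subset
    ((preimage_mono hIS).trans (φ.preimage_image S).subset)

theorem loopless (hφ : IsWeakMap φ M M') (hM' : M'.E = univ) (h : M'.Loopless) : M.Loopless := by
  rw [Matroid.loopless_iff_forall_isNonloop]
  intro e _
  have he : M'.Indep {φ e} :=
    Matroid.indep_singleton.2 (Matroid.isNonloop_of_loopless (hM' ▸ mem_univ _))
  have hpre := hφ.indep_preimage he
  rwa [← image_singleton, φ.preimage_image, Matroid.indep_singleton] at hpre

theorem rankFinite [M.RankFinite] (hφ : IsWeakMap φ M M') : M'.RankFinite := by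
  obtain ⟨B, hB⟩ := M'.exists_isBase
  exact ⟨B, hB, (hφ.isBase_preimage hB).finite.of_preimage φ.surjective⟩

end IsWeakMap

theorem exists_indep_isBasis_inter {C : Set (Flat M)} (hC : C.Finite) (hchain : IsChain (· ≤ ·) C) :
    ∃ I, M.Indep I ∧ ∀ F ∈ C, M.IsBasis (I ∩ F.1) F.1 := by
  classical
  obtain ⟨C, rfl⟩ := hC.exists_finset_coe
  induction C using Finset.strongInduction with
  | H C ih =>
    rcases C.eq_empty_or_nonempty with rfl | hne
    · exact ⟨∅, M.empty_indep, by simp⟩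
    obtain ⟨F, hF, hmax⟩ := C.exists_maximal hne
    have hle : ∀ G ∈ C, G ≤ F := fun G hG => (hchain.total hG hF).elim id (hmax hG)
    obtain ⟨I, hI, hIC⟩ := ih (C.erase F) (Finset.erase_ssubset hF) (Finset.finite_toSet _)
      (hchain.mono (Finset.coe_subset.2 (C.erase_subset F)))
    obtain ⟨J, hJ, hIJ⟩ := (hI.subset (inter_subset_left (t := F.1))).subset_isBasis_of_subset
      inter_subset_right F.2.subset_ground
    refine ⟨J, hJ.indep, fun G hG => ?_⟩
    obtain rfl | hGF := eq_or_ne G F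
    · rwa [inter_eq_self_of_subset_left hJ.subset]
    · have hG' := hIC G (Finset.mem_erase.2 ⟨hGF, hG⟩)
      have hsub : I ∩ G.1 ⊆ J ∩ G.1 := fun e he => ⟨hIJ ⟨he.1, hle G hG he.2⟩, he.2⟩
      rwa [← hG'.eq_of_subset_indep (hJ.indep.subset inter_subset_left) hsub inter_subset_right]

/-- The map on flats underlying the Whitney maps `Φ_k(φ)`. -/
def pushFlat (φ : E ≃ E') (M' : Matroid E') (F : Flat M) : Flat M' :=
  ⟨M'.closure (φ '' F.1), M'.isFlat_closure _⟩

theorem IsWeakMap.exists_monotone_lift (hφ : IsWeakMap φ M M') {C : Set (Flat M')}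
    (hC : C.Finite) (hchain : IsChain (· ≤ ·) C) (hfin : ∀ F ∈ C, M'.IsRkFinite F.1) :
    ∃ lift : Flat M' →o Flat M, ∀ F ∈ C,
      M.eRk (lift F).1 = M'.eRk F.1 ∧ pushFlat φ M' (lift F) = F := by
  obtain ⟨I, -, hIC⟩ := exists_indep_isBasis_inter hC hchain
  have hmono : Monotone fun F : Flat M' =>
      (⟨M.closure (φ ⁻¹' (I ∩ F.1)), M.isFlat_closure _⟩ : Flat M) := fun F G hFG =>
    M.closure_subset_closure (preimage_mono (inter_subset_inter_right I hFG))
  refine ⟨⟨_, hmono⟩, fun F hF => ?_⟩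
  have hbasis := hIC F hF
  have hindep := hφ.indep_preimage hbasis.indep
  have hrank : M.eRk (M.closure (φ ⁻¹' (I ∩ F.1))) = M'.eRk F.1 := by
    rw [Matroid.eRk_closure_eq, hindep.eRk_eq_encard,
      encard_preimage_of_bijective φ.bijective, hbasis.encard_eq_eRk]
  have hsub : I ∩ F.1 ⊆ φ '' M.closure (φ ⁻¹' (I ∩ F.1)) :=
    (image_preimage_eq _ φ.surjective).superset.trans
      (image_mono (M.subset_closure _ hindep.subset_ground))
  refine ⟨hrank, Subtype.ext ?_⟩
  calc M'.closure (φ '' M.closure (φ ⁻¹' (I ∩ F.1)))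
      = M'.closure (I ∩ F.1) :=
        ((hfin F hF).subset inter_subset_right).closure_eq_closure_of_subset_of_eRk_ge_eRk hsub
          ((hφ.eRk_image_le _).trans (hrank.trans hbasis.eRk_eq_eRk.symm).le) |>.symm
    _ = F.1 := by rw [hbasis.closure_eq_closure, F.2.closure]

end WeakMaps

section ChowFunctors

variable {E E' : Type*} {M : Matroid E} {M' : Matroid E'} {φ : E ≃ E'}

namespace IsWeakMap

theorem exists_flag_push_eq (hφ : IsWeakMap φ M M') {r : ℕ} {k : Fin r → ℕ} (F' : Flag M' k) :
    ∃ (F : Flag M k) (h : ∀ i, M'.eRk (φ '' F.1 i) = (k i : ℕ∞)), F.push φ M' h = F' := by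
  let flat (i : Fin r) : Flat M' := ⟨F'.1 i, (F'.2.1 i).1⟩
  have hmono : Monotone flat := F'.2.2
  have hrk (i : Fin r) : M'.eRk (flat i).1 = (k i : ℕ∞) := (F'.2.1 i).2
  obtain ⟨lift, hlift⟩ := hφ.exists_monotone_lift (Set.finite_range flat) hmono.isChain_range (by
    rintro _ ⟨i, rfl⟩
    rw [← Matroid.eRk_ne_top_iff, hrk]
    exact ENat.natCast_ne_top _)
  have hrank (i : Fin r) := ((hlift _ ⟨i, rfl⟩).1.trans (hrk i))
  have hpush (i : Fin r) : M'.closure (φ '' (lift (flat i)).1) = F'.1 i :=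
    congrArg Subtype.val (hlift _ ⟨i, rfl⟩).2
  refine ⟨⟨fun i => (lift (flat i)).1, fun i => ⟨(lift (flat i)).2, hrank i⟩,
    lift.monotone.comp hmono⟩, fun i => ?_, Subtype.ext (funext hpush)⟩
  rw [← M'.eRk_closure_eq, hpush]
  exact hrk i

theorem whitneyMap_surjective (hφ : IsWeakMap φ M M') {r : ℕ} (k : Fin r → ℕ) :
    Function.Surjective (whitneyMap φ M M' k) := by
  rw [← LinearMap.range_eq_top, eq_top_iff, ← Finsupp.basisSingleOne.span_eq, Submodule.span_le]
  rintro _ ⟨F', rfl⟩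
  obtain ⟨F, h, hF⟩ := hφ.exists_flag_push_eq F'
  refine ⟨Finsupp.single F 1, ?_⟩
  rw [whitneyMap, Finsupp.linearCombination_single, one_smul, dif_pos h, hF,
    Finsupp.coe_basisSingleOne]

theorem chowSumMap_surjective (hφ : IsWeakMap φ M M') (d : ℕ) :
    Function.Surjective (chowSumMap φ M M' d) :=
  (DirectSum.lmap_surjective _).2 fun _ =>
    LinearMap.rTensor_surjective _ (hφ.whitneyMap_surjective _)

theorem augChowMap_surjective (hφ : IsWeakMap φ M M') (d : ℕ) :
    Function.Surjective (augChowMap φ M M' d) :=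
  (DirectSum.lmap_surjective _).2 fun _ =>
    LinearMap.rTensor_surjective _ (hφ.whitneyMap_surjective _)

theorem chowMap_surjective (hφ : IsWeakMap φ M M') (hM' : M'.E = Set.univ) (d : ℕ) :
    Function.Surjective (chowMap φ M M' d) := by
  intro t
  by_cases hl' : M'.Loopless
  · have hl := hφ.loopless hM' hl'
    obtain ⟨s, hs⟩ := hφ.chowSumMap_surjective d (t ⟨hl'⟩)
    refine ⟨fun _ => s, funext fun _ => ?_⟩
    rw [chowMap, LinearMap.pi_apply, dif_pos hl]
    exact hs
  · exact ⟨0, funext fun h => absurd h.down hl'⟩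

end IsWeakMap

end ChowFunctors

section ChowRings

open MvPolynomial Set

attribute [local instance] rankFinite_of_finite_flat

variable {E : Type*} {M : Matroid E} {e : E}

/-- Elimination of the variables `y_e` by the linear relations of the augmented Chow ring. -/
noncomputable def eliminate (M : Matroid E) : PolyRing M →ₐ[ℚ] MvPolynomial (Flat M) ℚ :=
  aeval (Sum.elim X fun e => varSum ℚ {F : Flat M | e ∉ F.1})

theorem eliminate_x (F : Flat M) : eliminate M (x F) = X F := aeval_X _ _

theorem eliminate_y (M : Matroid E) (e : E) :
    eliminate M (y M e) = varSum ℚ {F : Flat M | e ∉ F.1} := aeval_X _ _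

theorem eliminate_rename (p : MvPolynomial (Flat M) ℚ) : eliminate M (rename Sum.inl p) = p := by
  rw [eliminate, aeval_rename, Sum.elim_comp_inl, aeval_X_left_apply]

/-- The presentation of the Chow ring by the generators `x_F` and `y_e`. -/
noncomputable def toChowRing (M : Matroid E) : PolyRing M →ₐ[ℚ] ChowRing M :=
  (Ideal.Quotient.mkₐ ℚ (chowIdeal M)).comp (Ideal.Quotient.mkₐ ℚ (augChowIdeal M))

theorem chowRingPiece_eq_map (M : Matroid E) (d : ℕ) :
    chowRingPiece M d =
      (homogeneousSubmodule (Flat M ⊕ E) ℚ d).map (toChowRing M).toLinearMap :=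
  (Submodule.map_comp _ _ _).symm

theorem ker_toChowRing (hl : M.Loopless) :
    RingHom.ker (toChowRing M) = Ideal.span (range (y M)) ⊔ augChowIdeal M := by
  ext p
  rw [← Ideal.mem_quotient_iff_mem_sup, Ideal.map_span, ← range_comp, RingHom.mem_ker, toChowRing,
    AlgHom.comp_apply, Ideal.Quotient.mkₐ_eq_mk, Ideal.Quotient.mkₐ_eq_mk,
    Ideal.Quotient.eq_zero_iff_mem, chowIdeal, if_pos hl]
  rfl

theorem finrank_chowRingPiece_of_not_loopless (hl : ¬ M.Loopless) (d : ℕ) :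
    Module.finrank ℚ (chowRingPiece M d) = 0 := by
  have : Subsingleton (ChowRing M) := by
    rw [Ideal.Quotient.subsingleton_iff, chowIdeal, if_neg hl]
  exact Module.finrank_zero_of_subsingleton

variable [Finite (Flat M)]

theorem eliminate_y_eq_sub (he : e ∈ M.E) :
    eliminate M (y M e) = upperSum ℚ (⊥ : Flat M) - upperSum ℚ (pointFlat M e) := by
  rw [eliminate_y, varSum_sub_varSum (Ici_subset_Ici.2 bot_le)]
  congr 1
  ext F
  simp [pointFlat_le_iff he]

theorem rename_varSum (s : Set (Flat M)) :
    rename Sum.inl (varSum ℚ s) = (∑ᶠ F ∈ s, x F : PolyRing M) := by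
  simp only [map_varSum, rename_X, x]

theorem augChowIdeal_le_iff {J : Ideal (PolyRing M)} :
    augChowIdeal M ≤ J ↔ rename Sum.inl (upperSum ℚ (⊥ : Flat M)) ∈ J ∧
      (∀ e, y M e - rename Sum.inl (varSum ℚ {F : Flat M | e ∉ F.1}) ∈ J) ∧
      (∀ (e : E) (F : Flat M), e ∉ F.1 → y M e * x F ∈ J) ∧
      ∀ F G : Flat M, ¬ F ≤ G → ¬ G ≤ F → x F * x G ∈ J := by
  simp only [rename_varSum, Ici_bot, finsum_mem_univ, augChowIdeal, sup_le_iff, Ideal.span_le,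
    and_assoc, singleton_subset_iff]
  refine and_congr Iff.rfl (and_congr ?_ (and_congr ?_ ?_))
  · exact ⟨fun h e => h ⟨e, rfl⟩, by rintro h _ ⟨e, rfl⟩; exact h e⟩
  · exact ⟨fun h e F heF => h ⟨e, F, heF, rfl⟩, by rintro h _ ⟨e, F, heF, rfl⟩; exact h e F heF⟩
  · exact ⟨fun h F G hFG hGF => h ⟨F, G, hFG, hGF, rfl⟩,
      by rintro h _ ⟨F, G, hFG, hGF, rfl⟩; exact h F G hFG hGF⟩

theorem augChowIdeal_le_comap_eliminate_iff (hM : M.E = univ)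
    {K : Ideal (MvPolynomial (Flat M) ℚ)} :
    augChowIdeal M ≤ K.comap (eliminate M) ↔ IsChowIdeal flatRank K := by
  have hmem (e : E) : e ∈ M.E := hM ▸ mem_univ e
  have hatom (hbot : upperSum ℚ ⊥ ∈ K) (e : E) (F : Flat M) :
      eliminate M (y M e * x F) ∈ K ↔ X F * upperSum ℚ (pointFlat M e) ∈ K := by
    rw [map_mul, eliminate_x, eliminate_y_eq_sub (hmem e), sub_mul,
      K.sub_mem_iff_right (K.mul_mem_right _ hbot), mul_comm]
  simp only [augChowIdeal_le_iff, Ideal.mem_comap, eliminate_rename]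
  constructor
  · rintro ⟨hbot, -, hpoint, hincomp⟩
    refine ⟨fun hGH hHG => ?_, fun {a F} ha haF => ?_, hbot⟩
    · simpa only [map_mul, eliminate_x] using hincomp _ _ hGH hHG
    · obtain ⟨e, rfl⟩ := exists_pointFlat_eq ha
      exact (hatom hbot e F).1 (hpoint e F fun heF => haF ((pointFlat_le_iff (hmem e)).2 heF))
  · refine fun hK => ⟨hK.bot, fun e => ?_, fun e F heF => (hatom hK.bot e F).2 ?_,
      fun F G hFG hGF => ?_⟩
    · rw [map_sub, eliminate_rename, eliminate_y, sub_self]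
      exact K.zero_mem
    · have he : M.IsNonloop e :=
        (M.not_isLoop_iff (hmem e)).1 fun h => heF (h.mem_of_isFlat F.2)
      exact hK.atom (flatRank_pointFlat he) fun h => heF ((pointFlat_le_iff (hmem e)).1 h)
    · rw [map_mul, eliminate_x, eliminate_x]
      exact hK.incomp hFG hGF

theorem comap_eliminate_comap_rename {J : Ideal (PolyRing M)} (hJ : augChowIdeal M ≤ J) :
    (J.comap (rename Sum.inl : MvPolynomial (Flat M) ℚ →ₐ[ℚ] PolyRing M)).comap (eliminate M) =
      J := by
  have hcomp : (Ideal.Quotient.mkₐ ℚ J).comp ((rename Sum.inl).comp (eliminate M)) =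
      Ideal.Quotient.mkₐ ℚ J := by
    refine algHom_ext fun v => ?_
    obtain F | e := v
    · exact congrArg (fun p => Ideal.Quotient.mkₐ ℚ J (rename Sum.inl p)) (eliminate_x F) |>.trans
        (by rw [rename_X])
    · have hy := (Ideal.Quotient.eq (I := J)).2 ((augChowIdeal_le_iff.1 hJ).2.1 e)
      rw [← eliminate_y] at hy
      exact hy.symm
  ext p
  rw [Ideal.mem_comap, Ideal.mem_comap, ← Ideal.Quotient.eq_zero_iff_mem,
    ← Ideal.Quotient.eq_zero_iff_mem]
  exact (DFunLike.congr_fun hcomp p).congr_left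

theorem eq_comap_eliminate {J : Ideal (PolyRing M)} {I : Ideal (MvPolynomial (Flat M) ℚ)}
    (hJ : augChowIdeal M ≤ J) (hJI : J ≤ I.comap (eliminate M))
    (hIJ : I ≤ J.comap (rename Sum.inl : MvPolynomial (Flat M) ℚ →ₐ[ℚ] PolyRing M)) :
    J = I.comap (eliminate M) :=
  le_antisymm hJI ((Ideal.comap_mono hIJ).trans (comap_eliminate_comap_rename hJ).le)

theorem isChowIdeal_comap_rename (hM : M.E = univ) {J : Ideal (PolyRing M)}
    (hJ : augChowIdeal M ≤ J) : IsChowIdeal flatRank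
      (J.comap (rename Sum.inl : MvPolynomial (Flat M) ℚ →ₐ[ℚ] PolyRing M)) :=
  (augChowIdeal_le_comap_eliminate_iff hM).1 (hJ.trans (comap_eliminate_comap_rename hJ).ge)

theorem augChowIdeal_eq_comap (hM : M.E = univ) :
    augChowIdeal M =
      (straighteningIdeal ℚ flatRank (fun F : Flat M => flatRank F + 1) univ).comap
        (eliminate M) := by
  have hr := isGeometricRank_flatRank (M := M)
  refine eq_comap_eliminate le_rfl ((augChowIdeal_le_comap_eliminate_iff hM).2 ?_)
    ((isChowIdeal_comap_rename hM le_rfl).straighteningIdeal_succ_le hr)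
  exact isChowIdeal_straighteningIdeal hr.toIsSubmodularRank (by rw [hr.bot])

theorem span_y_sup_augChowIdeal_eq_comap (hM : M.E = univ) :
    Ideal.span (range (y M)) ⊔ augChowIdeal M =
      (straighteningIdeal ℚ flatRank (fun F : Flat M => max 1 (flatRank F)) univ).comap
        (eliminate M) := by
  have hr := isGeometricRank_flatRank (M := M)
  have hmem (e : E) : e ∈ M.E := hM ▸ mem_univ e
  set I := straighteningIdeal ℚ flatRank (fun F : Flat M => max 1 (flatRank F)) univ
  have hI : IsChowIdeal flatRank I :=
    isChowIdeal_straighteningIdeal hr.toIsSubmodularRank (by rw [hr.bot, max_eq_left zero_le_one])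
  have hK := isChowIdeal_comap_rename hM
    (le_sup_right : augChowIdeal M ≤ Ideal.span (range (y M)) ⊔ augChowIdeal M)
  refine eq_comap_eliminate le_sup_right
    (sup_le (Ideal.span_le.2 ?_) ((augChowIdeal_le_comap_eliminate_iff hM).2 hI))
    (hK.straighteningIdeal_max_le hr fun a ha => ?_)
  · rintro _ ⟨e, rfl⟩
    have hpow : upperSum ℚ (pointFlat M e) ^ max 1 (flatRank (pointFlat M e)) ∈ I :=
      (StraighteningRelation.pow (mem_univ _)).mem
    rw [max_eq_left (flatRank_pointFlat_le_one M e), pow_one] at hpow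
    rw [SetLike.mem_coe, Ideal.mem_comap, eliminate_y_eq_sub (hmem e)]
    exact I.sub_mem hI.bot hpow
  · obtain ⟨e, rfl⟩ := exists_pointFlat_eq ha
    have hy : eliminate M (y M e) ∈ (Ideal.span (range (y M)) ⊔ augChowIdeal M).comap
        (rename Sum.inl : MvPolynomial (Flat M) ℚ →ₐ[ℚ] PolyRing M) := by
      rw [← Ideal.mem_comap, comap_eliminate_comap_rename le_sup_right]
      exact Ideal.mem_sup_left (Ideal.subset_span (mem_range_self e))
    rwa [eliminate_y_eq_sub (hmem e), Submodule.sub_mem_iff_right _ hK.bot] at hy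

theorem finrank_augChowRingPiece (hM : M.E = univ) (d : ℕ) :
    Module.finrank ℚ (augChowRingPiece M d) =
      (standardExponents flatRank (fun F : Flat M => flatRank F + 1) d).ncard := by
  have hr := (isGeometricRank_flatRank (M := M)).toIsSubmodularRank
  exact finrank_map_homogeneousSubmodule_sum hr hr.isBound_succ (fun _ => isHomogeneous_varSum _)
    ((Ideal.Quotient.mkₐ_ker ℚ _).trans (augChowIdeal_eq_comap hM)) d

theorem finrank_chowRingPiece (hM : M.E = univ) (hl : M.Loopless) (d : ℕ) :
    Module.finrank ℚ (chowRingPiece M d) =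
      (standardExponents flatRank (fun F : Flat M => max 1 (flatRank F)) d).ncard := by
  have hr := (isGeometricRank_flatRank (M := M)).toIsSubmodularRank
  have h := finrank_map_homogeneousSubmodule_sum (A := ChowRing M) hr hr.isBound_max
    (l := fun e => varSum ℚ {F : Flat M | e ∉ F.1}) (fun _ => isHomogeneous_varSum _)
    (q := toChowRing M) (by rw [ker_toChowRing hl]; exact span_y_sup_augChowIdeal_eq_comap hM) d
  rwa [← chowRingPiece_eq_map] at h

theorem exists_finrank_augChowRingPiece_eq_zero (hM : M.E = univ) :
    ∃ N, ∀ d > N, Module.finrank ℚ (augChowRingPiece M d) = 0 := by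
  obtain ⟨N, hN⟩ := standardExponents_eq_empty flatRank fun F : Flat M => flatRank F + 1
  exact ⟨N, fun d hd => by rw [finrank_augChowRingPiece hM, hN d hd, ncard_empty]⟩

theorem exists_finrank_chowRingPiece_eq_zero (hM : M.E = univ) :
    ∃ N, ∀ d > N, Module.finrank ℚ (chowRingPiece M d) = 0 := by
  by_cases hl : M.Loopless
  · obtain ⟨N, hN⟩ := standardExponents_eq_empty flatRank fun F : Flat M => max 1 (flatRank F)
    exact ⟨N, fun d hd => by rw [finrank_chowRingPiece hM hl, hN d hd, ncard_empty]⟩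
  · exact ⟨0, fun d _ => finrank_chowRingPiece_of_not_loopless hl d⟩

end ChowRings

section Comparison

attribute [local instance] rankFinite_of_finite_flat

variable {E E' : Type*} {M : Matroid E} {M' : Matroid E'} {φ : E ≃ E'} [Finite (Flat M)]

namespace IsWeakMap

theorem finite_flat (hφ : IsWeakMap φ M M') : Finite (Flat M') := by
  have := hφ.rankFinite
  refine Finite.of_surjective (pushFlat φ M' : Flat M → Flat M') fun F => ?_
  obtain ⟨lift, hlift⟩ := hφ.exists_monotone_lift (Set.finite_singleton F) IsChain.singleton
    fun G _ => M'.isRkFinite_set G.1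
  exact ⟨lift F, (hlift F rfl).2⟩

theorem ncard_standardExponents_le (hφ : IsWeakMap φ M M') (β : ℕ → ℕ) (d : ℕ) :
    (standardExponents flatRank (fun F : Flat M' => β (flatRank F)) d).ncard ≤
      (standardExponents flatRank (fun F : Flat M => β (flatRank F)) d).ncard := by
  have := hφ.rankFinite
  refine MatroidChow.ncard_standardExponents_le (push := pushFlat φ M') (fun C hC hchain => ?_) d
  obtain ⟨lift, hlift⟩ := hφ.exists_monotone_lift hC hchain fun F _ => M'.isRkFinite_set F.1
  have hrank {F} (hF : F ∈ C) : flatRank (lift F) = flatRank F :=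
    congrArg ENat.toNat (hlift F hF).1
  exact ⟨lift, fun F hF => ⟨hrank hF, congrArg β (hrank hF), (hlift F hF).2⟩⟩

theorem finrank_augChowRingPiece_le (hφ : IsWeakMap φ M M') (hM : M.E = Set.univ)
    (hM' : M'.E = Set.univ) (d : ℕ) :
    Module.finrank ℚ (augChowRingPiece M' d) ≤ Module.finrank ℚ (augChowRingPiece M d) := by
  have := hφ.finite_flat
  rw [finrank_augChowRingPiece hM, finrank_augChowRingPiece hM']
  exact hφ.ncard_standardExponents_le (· + 1) d

theorem finrank_chowRingPiece_le (hφ : IsWeakMap φ M M') (hM : M.E = Set.univ)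
    (hM' : M'.E = Set.univ) (d : ℕ) :
    Module.finrank ℚ (chowRingPiece M' d) ≤ Module.finrank ℚ (chowRingPiece M d) := by
  have := hφ.finite_flat
  by_cases hl' : M'.Loopless
  · rw [finrank_chowRingPiece hM (hφ.loopless hM' hl'), finrank_chowRingPiece hM' hl']
    exact hφ.ncard_standardExponents_le (max 1) d
  · exact (finrank_chowRingPiece_of_not_loopless hl' d).trans_le (Nat.zero_le _)

end IsWeakMap

theorem exists_polynomial_eq_mk {R : Type*} [Semiring R] {s : ℕ → R}
    (hs : ∃ N, ∀ d > N, s d = 0) : ∃ P : Polynomial R, (P : PowerSeries R) = PowerSeries.mk s := by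
  obtain ⟨N, hN⟩ := hs
  refine ⟨PowerSeries.trunc (N + 1) (PowerSeries.mk s), PowerSeries.ext fun d => ?_⟩
  rw [Polynomial.coeff_coe, PowerSeries.coeff_trunc, PowerSeries.coeff_mk, ite_eq_left_iff]
  exact fun hd => (hN d (by omega)).symm

theorem exists_polynomials_of_le {s s' : ℕ → ℕ} (hs : ∃ N, ∀ d > N, s d = 0)
    (hle : ∀ d, s' d ≤ s d) :
    ∃ P P' : Polynomial ℤ, (P : PowerSeries ℤ) = PowerSeries.mk (fun d => (s d : ℤ)) ∧
      (P' : PowerSeries ℤ) = PowerSeries.mk (fun d => (s' d : ℤ)) ∧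
      ∀ i, 0 ≤ (P - P').coeff i := by
  obtain ⟨N, hN⟩ := hs
  obtain ⟨P, hP⟩ := exists_polynomial_eq_mk (s := fun d => (s d : ℤ))
    ⟨N, fun d hd => by rw [hN d hd, Nat.cast_zero]⟩
  obtain ⟨P', hP'⟩ := exists_polynomial_eq_mk (s := fun d => (s' d : ℤ))
    ⟨N, fun d hd => by rw [Nat.le_zero.1 ((hle d).trans_eq (hN d hd)), Nat.cast_zero]⟩
  refine ⟨P, P', hP, hP', fun i => ?_⟩
  rw [Polynomial.coeff_sub, ← Polynomial.coeff_coe, ← Polynomial.coeff_coe, hP, hP',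
    PowerSeries.coeff_mk, PowerSeries.coeff_mk, sub_nonneg, Nat.cast_le]
  exact hle i

end Comparison

end MatroidChow

theorem corollary8p16_general {E : Type*} {E' : Type*} (M : Matroid E) (M' : Matroid E')
    [Finite (MatroidChow.Flat M)] (hM : M.E = Set.univ) (hM' : M'.E = Set.univ)
    (φ : E ≃ E') (hφ : MatroidChow.IsWeakMap φ M M') :
    (∀ d : ℕ, Function.Surjective (MatroidChow.chowMap φ M M' d)) ∧
    (∀ d : ℕ, Function.Surjective (MatroidChow.augChowMap φ M M' d)) ∧
    (∃ P P' : Polynomial ℤ,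
      (P : PowerSeries ℤ) = MatroidChow.chowSeries M ∧
      (P' : PowerSeries ℤ) = MatroidChow.chowSeries M' ∧
      ∀ i : ℕ, 0 ≤ (P - P').coeff i) ∧
    (∃ P P' : Polynomial ℤ,
      (P : PowerSeries ℤ) = MatroidChow.augChowSeries M ∧
      (P' : PowerSeries ℤ) = MatroidChow.augChowSeries M' ∧
      ∀ i : ℕ, 0 ≤ (P - P').coeff i) :=
  ⟨hφ.chowMap_surjective hM', hφ.augChowMap_surjective,
    MatroidChow.exists_polynomials_of_le (MatroidChow.exists_finrank_chowRingPiece_eq_zero hM)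
      (hφ.finrank_chowRingPiece_le hM hM'),
    MatroidChow.exists_polynomials_of_le (MatroidChow.exists_finrank_augChowRingPiece_eq_zero hM)
      (hφ.finrank_augChowRingPiece_le hM hM')⟩

theorem corollary8p16 {E : Type*} {E' : Type*} [Finite E] [Finite E']
    (M : Matroid E) (M' : Matroid E') (hM : M.E = Set.univ) (hM' : M'.E = Set.univ)
    (φ : E ≃ E') (hφ : MatroidChow.IsWeakMap φ M M') :
    (∀ d : ℕ, Function.Surjective (MatroidChow.chowMap φ M M' d)) ∧
    (∀ d : ℕ, Function.Surjective (MatroidChow.augChowMap φ M M' d)) ∧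
    (∃ P P' : Polynomial ℤ,
      (P : PowerSeries ℤ) = MatroidChow.chowSeries M ∧
      (P' : PowerSeries ℤ) = MatroidChow.chowSeries M' ∧
      ∀ i : ℕ, 0 ≤ (P - P').coeff i) ∧
    (∃ P P' : Polynomial ℤ,
      (P : PowerSeries ℤ) = MatroidChow.augChowSeries M ∧
      (P' : PowerSeries ℤ) = MatroidChow.augChowSeries M' ∧
      ∀ i : ℕ, 0 ≤ (P - P').coeff i) := by
  have : Finite (MatroidChow.Flat M) := Subtype.finite
  exact corollary8p16_general M M' hM hM' φ hφ
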